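/- **Setting.** Let $k\in\{0,1,2,3,4\}$, $t_0<T$, $\alpha_0>0$, let $\Omega_{\mathbf x}\subset\mathbb R^3$ be open and bounded, and let $\alpha=\alpha(\mathbf x,t)$ and $\boldsymbol\beta=\boldsymbol\beta(\mathbf x,t)$ be essentially bounded on $\Omega_{\mathbf x}\times(t_0,T)$ with $\alpha\ge\alpha_0$ almost everywhere. Identify spatial $k$-forms with scalar fields ($k=0,3$), vector fields ($k=1,2$), and zero ($k=4$). Let $\mathrm d$ be the spatial exterior derivative, that is $\nabla,\ \nabla\times,\ \nabla\cdot,\ 0,\ 0$ for $k=0,1,2,3,4$, let $\delta$ be its formal $L^2$-adjoint, and let $\boldsymbol\beta\wedge u$ be $\boldsymbol\beta u,\ \boldsymbol\beta\times u,\ \boldsymbol\beta\cdot u,\ 0,\ 0$. Let $V_{\mathbf x}$ be the closure of the smooth compactly supported $k$-forms in $\Omega_{\mathbf x}$ under the norm $\|v\|_{V_{\mathbf x}}=(\|v\|_{L^2(\Omega_{\mathbf x})}^2+\|\mathrm dv\|_{L^2(\Omega_{\mathbf x})}^2)^{1/2}$, that is $H^1_0$, $H_0(\mathbf{curl})$,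 $H_0(\mathrm{div})$, $L^2$, $0$. Let $\mathcal L$ be the weak form of the convection-diffusion operator, $-\langle\mathcal Lu,\varphi\rangle=(\alpha\,\mathrm du+\boldsymbol\beta\wedge u,\ \mathrm d\varphi)_{\Omega_{\mathbf x}}$; thus $\mathcal Lu=\nabla\cdot(\alpha\nabla u+\boldsymbol\beta u)$, $-\nabla\times(\alpha\nabla\times u+\boldsymbol\beta\times u)$, $\nabla(\alpha\nabla\cdot u+\boldsymbol\beta\cdot u)$, $0$, $0$. Given a source $f(t)\in L^2(\Omega_{\mathbf x})$ and an initial datum $u_{t_0}\in L^2(\Omega_{\mathbf x})$, let $u^0$ be a solution of $$u_t-\mathcal Lu=f,\qquad u(t)\in V_{\mathbf x},\qquad u(t_0)=u_{t_0},$$ and, for $\varepsilon>0$, let $u^\varepsilon$ be a solution of the spatiotemporal problem $$-\varepsilon u_{tt}+u_t-\mathcal Lu+\varepsilon\,\mathrm d\delta u=f,\qquad \delta u=0,\qquad u(t)\in V_{\mathbf x},\qquad u(t_0)=u_{t_0},\qquad \varepsilon u_t(T)=0,$$ where for $k=0$ the terms with $\delta$ are absent. The equations hold for almost every $t$ in the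 sense of distributions on $\Omega_{\mathbf x}$. Assume $u^0,u^\varepsilon\in L^\infty([t_0,T];V_{\mathbf x})$, $u^0_t,u^\varepsilon_t\in L^\infty([t_0,T];V_{\mathbf x})$ and $u^0_{tt},u^\varepsilon_{tt}\in L^2([t_0,T];L^2(\Omega_{\mathbf x}))$; values at a given time are those of the continuous representatives. Put $e=u^\varepsilon-u^0$, $C_\ell=\|\boldsymbol\beta\|_{L^\infty}/(2\alpha_0)$ and $c_0=\alpha_0/2-\varepsilon(C_\ell^2+1/2)$. **Theorem.** (i) For every $b$ there is $\varepsilon_0>0$, depending only on $k,t_0,T,\alpha_0,b$, such that whenever $\|\boldsymbol\beta\|_{L^\infty}\le b$ and $0<\varepsilon<\varepsilon_0$ one has $c_0>0$ and, for all $t\in[t_0,T]$, $$\frac12\|e(t)\|_{L^2(\Omega_{\mathbf x})}^2+c_0\int_{t_0}^t\|e(s)\|_{V_{\mathbf x}}^2\,ds\le\frac\varepsilon2e^{2C_\ell(t-t_0)}\int_{t_0}^t\|u^0_{tt}(s)\|_{L^2(\Omega_{\mathbf x})}^2\,ds+\varepsilon\|e_t(t)\|_{L^2(\Omega_{\mathbf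 x})}\|e(t)\|_{V_{\mathbf x}}.$$ (ii) For fixed data and fixed $u^0$, if such a $u^\varepsilon$ is given for all sufficiently small $\varepsilon>0$, then $u^\varepsilon(t)\to u^0(t)$ in $L^2(\Omega_{\mathbf x})$ for every $t\in[t_0,T]$, and $u^\varepsilon\to u^0$ in $L^2([t_0,T];V_{\mathbf x})$, as $\varepsilon\to0^+$. -/

import Mathlib

open MeasureTheory Set Filter Topology
open scoped ENNReal ContDiff

noncomputable section

namespace SpaceTimeCD

/-- Points of physical space. -/
abbrev Pt : Type := EuclideanSpace ℝ (Fin 3)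

/-- Number of components of a spatial `k`-form on `ℝ³`. -/
abbrev comps : ℕ → ℕ
  | 0 => 1
  | 1 => 3
  | 2 => 3
  | 3 => 1
  | _ => 0

/-- Values of (the vector proxy of) a spatial `k`-form, with the Euclidean inner product:
scalars for `k = 0, 3`, vectors for `k = 1, 2` (components along `dx, dy, dz`, respectively
`dy ∧ dz, dz ∧ dx, dx ∧ dy`), and the zero space for `k ≥ 4`. -/
abbrev Form (k : ℕ) : Type := EuclideanSpace ℝ (Fin (comps k))

/-- The classical partial derivative `∂_j g` of a scalar function. -/
def pd (j : Fin 3) (g : Pt → ℝ) (x : Pt) : ℝ :=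
  fderiv ℝ g x (EuclideanSpace.single j 1)

/-- Gradient of a scalar field. -/
def gradF (g : Pt → ℝ) (x : Pt) : EuclideanSpace ℝ (Fin 3) :=
  !₂[pd 0 g x, pd 1 g x, pd 2 g x]

/-- Curl of a vector field. -/
def curlF (v : Pt → EuclideanSpace ℝ (Fin 3)) (x : Pt) : EuclideanSpace ℝ (Fin 3) :=
  !₂[pd 1 (fun y => v y 2) x - pd 2 (fun y => v y 1) x,
     pd 2 (fun y => v y 0) x - pd 0 (fun y => v y 2) x,
     pd 0 (fun y => v y 1) x - pd 1 (fun y => v y 0) x]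

/-- Divergence of a vector field. -/
def divF (v : Pt → EuclideanSpace ℝ (Fin 3)) (x : Pt) : ℝ :=
  pd 0 (fun y => v y 0) x + pd 1 (fun y => v y 1) x + pd 2 (fun y => v y 2) x

/-- The spatial exterior derivative: gradient, curl, divergence, and zero. -/
def extD : (k : ℕ) → (Pt → Form k) → Pt → Form (k + 1)
  | 0, u, x => gradF (fun y => u y (0 : Fin 1)) x
  | 1, u, x => curlF u x
  | 2, u, x => (!₂[divF u x] : EuclideanSpace ℝ (Fin 1))
  | _ + 3, _, _ => 0

/-- The formal `L²`-adjoint of `extD k`: minus divergence, curl, minus gradient, and zero. -/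
def coD : (k : ℕ) → (Pt → Form (k + 1)) → Pt → Form k
  | 0, v, x => (!₂[-divF v x] : EuclideanSpace ℝ (Fin 1))
  | 1, v, x => curlF v x
  | 2, v, x => -gradF (fun y => v y (0 : Fin 1)) x
  | _ + 3, _, _ => 0

/-- The product `β ∧ u` at a point: `β u`, `β × u`, `β · u`, and zero. -/
def wedge : (k : ℕ) → Pt → Form k → Form (k + 1)
  | 0, b, u => (u (0 : Fin 1) • b : EuclideanSpace ℝ (Fin 3))
  | 1, b, u =>
      let u' : EuclideanSpace ℝ (Fin 3) := u
      (!₂[b 1 * u' 2 - b 2 * u' 1, b 2 * u' 0 - b 0 * u' 2, b 0 * u' 1 - b 1 * u' 0] :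
        EuclideanSpace ℝ (Fin 3))
  | 2, b, u =>
      let u' : EuclideanSpace ℝ (Fin 3) := u
      (!₂[b 0 * u' 0 + b 1 * u' 1 + b 2 * u' 2] : EuclideanSpace ℝ (Fin 1))
  | _ + 3, _, _ => 0

/-- Test forms: smooth `k`-forms with compact support in `Ω`. -/
structure IsTest (k : ℕ) (Ω : Set Pt) (φ : Pt → Form k) : Prop where
  smooth : ContDiff ℝ ∞ φ
  compact : HasCompactSupport φ
  support : tsupport φ ⊆ Ω

/-- `L²(Ω)` for spatial `k`-forms. -/
abbrev L2 (k : ℕ) (Ω : Set Pt) : Type := Lp (Form k) 2 (volume.restrict Ω)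

/-- The graph of the exterior derivative on test forms, as a set of pairs `(φ, dφ)` in
`L² × L²` with the norm `(‖φ‖² + ‖dφ‖²)^(1/2)`. -/
def testGraph (k : ℕ) (Ω : Set Pt) : Set (WithLp 2 (L2 k Ω × L2 (k + 1) Ω)) :=
  {w | ∃ φ : Pt → Form k, IsTest k Ω φ ∧
    (w.fst : Pt → Form k) =ᵐ[volume.restrict Ω] φ ∧
    (w.snd : Pt → Form (k + 1)) =ᵐ[volume.restrict Ω] extD k φ}

/-- The spatial Sobolev space `V_x`, the closure of the test forms in the graph norm of the
exterior derivative: `H¹₀(Ω)`, `H₀(curl; Ω)`, `H₀(div; Ω)` and `L²(Ω)` for `k = 0, 1, 2, 3`.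
An element is a pair consisting of a form and its weak exterior derivative (which the form
determines), and the norm is `(‖u‖²_{L²} + ‖du‖²_{L²})^(1/2)`. -/
abbrev V (k : ℕ) (Ω : Set Pt) : Type :=
  (Submodule.span ℝ (testGraph k Ω)).topologicalClosure

variable {k : ℕ} {Ω : Set Pt}

/-- The form underlying an element of `V_x`, as an element of `L²(Ω)`. -/
def V.val (v : V k Ω) : L2 k Ω := (v : WithLp 2 (L2 k Ω × L2 (k + 1) Ω)).fst

/-- The weak exterior derivative of an element of `V_x`. -/
def V.d (v : V k Ω) : L2 (k + 1) Ω := (v : WithLp 2 (L2 k Ω × L2 (k + 1) Ω)).snd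

/-- The domain, coefficients, source and initial datum. The coefficients may depend on time. -/
structure Data (k : ℕ) (t₀ T α₀ : ℝ) where
  /-- the spatial domain -/
  Ω : Set Pt
  isOpen : IsOpen Ω
  bounded : Bornology.IsBounded Ω
  /-- the diffusion coefficient, `α t x` -/
  α : ℝ → Pt → ℝ
  /-- the convection field, `β t x` -/
  β : ℝ → Pt → Pt
  α_mem : MemLp (fun p : ℝ × Pt => α p.1 p.2) ∞
    ((volume.restrict (Icc t₀ T)).prod (volume.restrict Ω))
  β_mem : MemLp (fun p : ℝ × Pt => β p.1 p.2) ∞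
    ((volume.restrict (Icc t₀ T)).prod (volume.restrict Ω))
  α_ge : ∀ᵐ p : ℝ × Pt ∂((volume.restrict (Icc t₀ T)).prod (volume.restrict Ω)), α₀ ≤ α p.1 p.2
  /-- the source -/
  f : ℝ → L2 k Ω
  /-- the initial datum -/
  init : L2 k Ω

variable {t₀ T α₀ : ℝ}

/-- `‖β‖_{L^∞}`, over the domain and the time interval. -/
def Data.betaSup (D : Data k t₀ T α₀) : ℝ :=
  (eLpNorm (fun p : ℝ × Pt => D.β p.1 p.2) ∞
    ((volume.restrict (Icc t₀ T)).prod (volume.restrict D.Ω))).toReal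

/-- `C_ℓ = ‖β‖_{L^∞} / (2 α₀)`. -/
def Data.Cl (D : Data k t₀ T α₀) : ℝ := D.betaSup / (2 * α₀)

/-- `c₀ = α₀ / 2 - ε (C_ℓ² + 1/2)`. -/
def Data.c0 (D : Data k t₀ T α₀) (ε : ℝ) : ℝ := α₀ / 2 - ε * (D.Cl ^ 2 + 1 / 2)

/-- A time-dependent form together with its first and second time derivatives. -/
structure Trajectory (k : ℕ) (Ω : Set Pt) where
  /-- `u` -/
  u : ℝ → V k Ω
  /-- `u_t` -/
  ut : ℝ → V k Ω
  /-- `u_tt` -/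
  utt : ℝ → L2 k Ω

/-- `u, u_t ∈ L^∞([t₀,T]; V_x)` and `u_tt ∈ L²([t₀,T]; L²(Ω))`, where `u_t` and `u_tt` are the
weak time derivatives of `u` and `u_t`. The derivatives are expressed by Bochner integrals, so
that `u` (with values in `V_x`) and `u_t` (with values in `L²`) are the absolutely continuous
representatives, whose values at every time are meaningful. -/
structure Trajectory.Regular (U : Trajectory k Ω) (t₀ T : ℝ) : Prop where
  u_mem : MemLp U.u ∞ (volume.restrict (Icc t₀ T))
  ut_mem : MemLp U.ut ∞ (volume.restrict (Icc t₀ T))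
  utt_mem : MemLp U.utt 2 (volume.restrict (Icc t₀ T))
  deriv_u : ∀ t ∈ Icc t₀ T, U.u t = U.u t₀ + ∫ s in t₀..t, U.ut s
  deriv_ut : ∀ t ∈ Icc t₀ T, (U.ut t).val = (U.ut t₀).val + ∫ s in t₀..t, U.utt s

/-- The weak form of `-ℒ u` at time `t` against a test form:
`∫ ⟨α du + β ∧ u, dφ⟩`, where `-ℒ u` is `-∇·(α∇u + βu)`, `∇×(α∇×u + β×u)`, `-∇(α∇·u + β·u)`
and `0` for `k = 0, 1, 2, 3`. -/
def Data.spatial (D : Data k t₀ T α₀) (t : ℝ) (v : V k D.Ω) (φ : Pt → Form k) : ℝ :=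
  ∫ x in D.Ω, inner ℝ (D.α t x • (v.d : Pt → Form (k + 1)) x
    + wedge k (D.β t x) ((v.val : Pt → Form k) x)) (extD k φ x)

/-- The `L²` pairing of an element of `L²(Ω)` with a function. -/
def pair (w : L2 k Ω) (φ : Pt → Form k) : ℝ :=
  ∫ x in Ω, inner ℝ ((w : Pt → Form k) x) (φ x)

/-- `d δ φ`; this is `0`, `-∇(∇·φ)`, `∇×∇×φ`, `-Δφ` for `k = 0, 1, 2, 3`. -/
def dCoD : (k : ℕ) → (Pt → Form k) → Pt → Form k
  | 0, _, _ => 0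
  | k + 1, φ, x => extD k (coD k φ) x

/-- The weak form of `δ w = 0`: no condition, `∇·w = 0`, `∇×w = 0`, `∇w = 0` for
`k = 0, 1, 2, 3`. -/
def CoClosed : (k : ℕ) → (Ω : Set Pt) → L2 k Ω → Prop
  | 0, _, _ => True
  | k + 1, Ω, w => ∀ ψ : Pt → Form k, IsTest k Ω ψ → pair w (extD k ψ) = 0

/-- The original time-dependent convection-diffusion problem: `u_t - ℒ u = f` in `Ω` with
`u(t) ∈ V_x` (the homogeneous spatial boundary condition) and `u(t₀)` the initial datum. -/
structure IsLimitSolution (D : Data k t₀ T α₀) (U : Trajectory k D.Ω) : Prop where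
  equation : ∀ᵐ t ∂(volume.restrict (Icc t₀ T)), ∀ φ : Pt → Form k, IsTest k D.Ω φ →
    pair (U.ut t).val φ + D.spatial t (U.u t) φ = pair (D.f t) φ
  initial : (U.u t₀).val = D.init

/-- The spatiotemporal problem with temporal perturbation `ε`:
`-ε u_tt + u_t - ℒ u + ε d δ u = f` and `δ u = 0` in `Ω`, with `u(t) ∈ V_x` (the homogeneous
spatial boundary condition), `u(t₀)` the initial datum, and the artificial terminal condition
`ε u_t(T) = 0`. -/
structure IsPerturbedSolution (D : Data k t₀ T α₀) (ε : ℝ) (U : Trajectory k D.Ω) : Prop where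
  equation : ∀ᵐ t ∂(volume.restrict (Icc t₀ T)), ∀ φ : Pt → Form k, IsTest k D.Ω φ →
    -ε * pair (U.utt t) φ + pair (U.ut t).val φ + D.spatial t (U.u t) φ
      + ε * pair (U.u t).val (dCoD k φ) = pair (D.f t) φ
  coclosed : ∀ᵐ t ∂(volume.restrict (Icc t₀ T)), CoClosed k D.Ω (U.u t).val
  initial : (U.u t₀).val = D.init
  terminal : ε • (U.ut T).val = 0

end SpaceTimeCD

end

namespace SpaceTimeCD

/-! Subtract the two weak equations and test with `e`. The term with `dCoD` vanishes, because a
co-closed form is orthogonal to the exterior derivative of a test form and the coderivative of a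
test form is a test form. Extending the identity from test forms to `V` by density makes `e` itself
admissible, and coercivity of the flux gives, with `F = u⁰_tt`, the inequality of
`ae_energy_inequality`.

Integrating it in time, with integration by parts for `⟨e'', e⟩`, puts `½‖e(t)‖² + ε∫‖e'‖² +
(α₀/2)∫‖de‖²` on the left and `ε⟨e'(t), e(t)⟩ + K∫‖e‖² + ε∫⟨F, e⟩` on the right. The boundary term
admits no useful pointwise bound, so Grönwall's inequality is not applied to `‖e(t)‖²`. Integrating
once more in time turns that term into `ε∫⟨e', e⟩`, and Grönwall's inequality for `t ↦ ∫‖e‖²` bounds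
this integral by small multiples of `ε∫‖e'‖²` and `ε∫‖F‖²` (`integral_norm_sq_le_of_energy`). The
first is absorbed on the left. The resulting `energy_estimate` has no exponential factor, has `α₀/2`
in place of `c₀`, and keeps `(ε/2)∫‖e'‖²`; assertion (i) is weaker.

For (ii), take `t = T`. There `e_t(T) = -u⁰_t(T)` does not depend on `ε`, so the boundary term is
absorbed by `½‖e(T)‖²` up to `O(ε²)`. Hence `∫‖e‖²_V = O(ε)`, while `∫‖e_t‖²` stays bounded thanks
to the retained term. Interpolating between these through `‖e(t)‖² = 2∫⟨e, e_t⟩` gives `‖e(t)‖² =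
O(√ε)` at every time. -/

/-- A function whose increments are dominated by those of an absolutely continuous function is
absolutely continuous. -/
theorem absolutelyContinuousOnInterval_of_dist_le {X Y : Type*} [PseudoMetricSpace X]
    [PseudoMetricSpace Y] {f : ℝ → X} {g : ℝ → Y} {a b : ℝ}
    (hg : AbsolutelyContinuousOnInterval g a b)
    (h : ∀ x ∈ uIcc a b, ∀ y ∈ uIcc a b, dist (f x) (f y) ≤ dist (g x) (g y)) :
    AbsolutelyContinuousOnInterval f a b := by
  rw [absolutelyContinuousOnInterval_iff] at hg ⊢
  intro ε hε
  obtain ⟨δ, hδ, H⟩ := hg ε hε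
  refine ⟨δ, hδ, fun E hE hlt => lt_of_le_of_lt ?_ (H E hE hlt)⟩
  exact Finset.sum_le_sum fun i hi => h _ (hE.1 i hi).1 _ (hE.1 i hi).2

/-! ### Integration by parts for Hilbert-valued primitives -/

section Hilbert

variable {H : Type*} [NormedAddCommGroup H] [InnerProductSpace ℝ H]

theorem continuousOn_of_eq_add_integral {E : Type*} [NormedAddCommGroup E] [NormedSpace ℝ E]
    {a b : ℝ} (hab : a ≤ b) {p p' : ℝ → E} (hp' : IntervalIntegrable p' volume a b)
    (hp : ∀ t ∈ Icc a b, p t = p a + ∫ s in a..t, p' s) : ContinuousOn p (Icc a b) := by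
  have h := intervalIntegral.continuousOn_primitive_interval' hp' left_mem_uIcc
  rw [uIcc_of_le hab] at h
  exact (continuousOn_const.add h).congr hp

theorem dist_le_dist_integral_norm {E : Type*} [NormedAddCommGroup E] [NormedSpace ℝ E]
    {a b : ℝ} (hab : a ≤ b) {p p' : ℝ → E} (hp' : IntervalIntegrable p' volume a b)
    (hp : ∀ t ∈ Icc a b, p t = p a + ∫ s in a..t, p' s) {x y : ℝ}
    (hx : x ∈ Icc a b) (hy : y ∈ Icc a b) :
    dist (p x) (p y) ≤ |∫ s in x..y, ‖p' s‖| := by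
  have hsub : ∀ t ∈ Icc a b, IntervalIntegrable p' volume a t := fun t ht =>
    hp'.mono_set (by rw [uIcc_of_le ht.1, uIcc_of_le hab]; exact Icc_subset_Icc_right ht.2)
  rw [dist_comm, dist_eq_norm, hp x hx, hp y hy, add_sub_add_left_eq_sub,
    intervalIntegral.integral_interval_sub_left (hsub y hy) (hsub x hx)]
  exact intervalIntegral.norm_integral_le_abs_integral_norm

/-- Integration by parts for primitives of integrable functions with values in a Hilbert space. -/
theorem integral_inner_add_inner_eq_sub [CompleteSpace H] {a b : ℝ} (hab : a ≤ b)
    {p p' q q' : ℝ → H}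
    (hp' : IntervalIntegrable p' volume a b) (hq' : IntervalIntegrable q' volume a b)
    (hp : ∀ t ∈ Icc a b, p t = p a + ∫ s in a..t, p' s)
    (hq : ∀ t ∈ Icc a b, q t = q a + ∫ s in a..t, q' s) :
    ∫ s in a..b, (inner ℝ (p s) (q' s) + inner ℝ (p' s) (q s))
      = inner ℝ (p b) (q b) - inner ℝ (p a) (q a) := by
  have hpc := continuousOn_of_eq_add_integral hab hp' hp
  have hqc := continuousOn_of_eq_add_integral hab hq' hq
  obtain ⟨Cp, hCp⟩ := isCompact_Icc.exists_bound_of_continuousOn hpc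
  obtain ⟨Cq, hCq⟩ := isCompact_Icc.exists_bound_of_continuousOn hqc
  have hCp0 : 0 ≤ Cp := (norm_nonneg _).trans (hCp a (left_mem_Icc.2 hab))
  have hCq0 : 0 ≤ Cq := (norm_nonneg _).trans (hCq a (left_mem_Icc.2 hab))
  -- By the product rule, `g` majorizes the derivative of `⟨p, q⟩`. Its primitive dominates the
  -- increments of this scalar function, which reduces the claim to the fundamental theorem of
  -- calculus for real absolutely continuous functions.
  set g : ℝ → ℝ := fun s => Cq * ‖p' s‖ + Cp * ‖q' s‖ with hg
  have hgi : IntervalIntegrable g volume a b :=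
    (hp'.norm.const_mul Cq).add (hq'.norm.const_mul Cp)
  have hmono : ∀ {x y : ℝ}, x ∈ Icc a b → y ∈ Icc a b → uIcc x y ⊆ uIcc a b := by
    intro x y hx hy
    rw [uIcc_of_le hab]
    exact uIcc_subset_Icc hx hy
  have hac : AbsolutelyContinuousOnInterval (fun s => inner ℝ (p s) (q s)) a b := by
    refine absolutelyContinuousOnInterval_of_dist_le
      (hgi.absolutelyContinuousOnInterval_intervalIntegral (c := a) left_mem_uIcc) ?_
    rw [uIcc_of_le hab]
    intro x hx y hy
    have hpi : IntervalIntegrable p' volume x y := hp'.mono_set (hmono hx hy)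
    have hqi : IntervalIntegrable q' volume x y := hq'.mono_set (hmono hx hy)
    have ha : a ∈ Icc a b := left_mem_Icc.2 hab
    have h1 : dist (∫ v in a..x, g v) (∫ v in a..y, g v)
        = |Cq * (∫ s in x..y, ‖p' s‖) + Cp * ∫ s in x..y, ‖q' s‖| := by
      rw [dist_comm, Real.dist_eq, intervalIntegral.integral_interval_sub_left
        (hgi.mono_set (hmono ha hy)) (hgi.mono_set (hmono ha hx)), hg,
        intervalIntegral.integral_add (hpi.norm.const_mul Cq) (hqi.norm.const_mul Cp),
        intervalIntegral.integral_const_mul, intervalIntegral.integral_const_mul]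
    have h2 : |Cq * (∫ s in x..y, ‖p' s‖) + Cp * ∫ s in x..y, ‖q' s‖|
        = Cq * |∫ s in x..y, ‖p' s‖| + Cp * |∫ s in x..y, ‖q' s‖| := by
      rcases le_total x y with hxy | hxy
      · have e1 : 0 ≤ ∫ s in x..y, ‖p' s‖ :=
          intervalIntegral.integral_nonneg hxy fun _ _ => norm_nonneg _
        have e2 : 0 ≤ ∫ s in x..y, ‖q' s‖ :=
          intervalIntegral.integral_nonneg hxy fun _ _ => norm_nonneg _
        rw [abs_of_nonneg e1, abs_of_nonneg e2, abs_of_nonneg (by positivity)]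
      · have e1 : 0 ≤ ∫ s in y..x, ‖p' s‖ :=
          intervalIntegral.integral_nonneg hxy fun _ _ => norm_nonneg _
        have e2 : 0 ≤ ∫ s in y..x, ‖q' s‖ :=
          intervalIntegral.integral_nonneg hxy fun _ _ => norm_nonneg _
        rw [intervalIntegral.integral_symm y x, intervalIntegral.integral_symm y x, abs_neg,
          abs_neg, abs_of_nonneg e1, abs_of_nonneg e2, mul_neg, mul_neg, ← neg_add, abs_neg,
          abs_of_nonneg (by positivity)]
    rw [h1, h2]
    have h3 : inner ℝ (p x) (q x) - inner ℝ (p y) (q y)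
        = inner ℝ (p x - p y) (q x) + inner ℝ (p y) (q x - q y) := by
      rw [inner_sub_left, inner_sub_right]; ring
    rw [Real.dist_eq, h3]
    refine (abs_add_le _ _).trans (add_le_add ?_ ?_)
    · refine (abs_real_inner_le_norm _ _).trans ?_
      rw [mul_comm, ← dist_eq_norm]
      exact mul_le_mul (hCq x hx) (dist_le_dist_integral_norm hab hp' hp hx hy) dist_nonneg hCq0
    · refine (abs_real_inner_le_norm _ _).trans ?_
      rw [← dist_eq_norm]
      exact mul_le_mul (hCp y hy) (dist_le_dist_integral_norm hab hq' hq hx hy) dist_nonneg hCp0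
  rw [← hac.integral_deriv_eq_sub]
  apply intervalIntegral.integral_congr_ae
  -- The representations of `p` and `q` hold only on `Icc a b`, so differentiating them requires an
  -- interior point.
  have hb : ∀ᵐ x, x ≠ b := by simp [ae_iff, measure_singleton]
  filter_upwards [hp'.ae_hasDerivAt_integral, hq'.ae_hasDerivAt_integral, hb] with x h1 h2 hxb hx
  rw [uIoc_of_le hab] at hx
  have hxI : x ∈ uIcc a b := by rw [uIcc_of_le hab]; exact Ioc_subset_Icc_self hx
  have hnhds : Icc a b ∈ 𝓝 x := Icc_mem_nhds hx.1 (lt_of_le_of_ne hx.2 hxb)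
  have d1 : HasDerivAt p (p' x) x :=
    ((h1 hxI a left_mem_uIcc).const_add (p a)).congr_of_eventuallyEq
      (Filter.eventually_of_mem hnhds hp)
  have d2 : HasDerivAt q (q' x) x :=
    ((h2 hxI a left_mem_uIcc).const_add (q a)).congr_of_eventuallyEq
      (Filter.eventually_of_mem hnhds hq)
  exact (d1.inner ℝ d2).deriv.symm

end Hilbert

/-! ### Grönwall's inequality and interval integrals -/

/-- Grönwall's inequality in integral form. -/
theorem le_mul_exp_of_le_add_integral {a b A K : ℝ} (hab : a ≤ b) (hK : 0 < K)
    {f : ℝ → ℝ} (hf : ContinuousOn f (Icc a b)) (hf0 : ∀ t ∈ Icc a b, 0 ≤ f t)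
    (h : ∀ t ∈ Icc a b, f t ≤ A + K * ∫ s in a..t, f s) :
    f b ≤ A * Real.exp (K * (b - a)) := by
  -- The continuous extension makes the primitive `Z` differentiable everywhere, end points
  -- included. The differential form of Grönwall then applies to `Z' ≤ K Z + A` with `Z a = 0`, and
  -- `f b ≤ A + K Z b` concludes.
  set g : ℝ → ℝ := IccExtend hab ((Icc a b).domRestrict f) with hg
  have hgc : Continuous g := (continuousOn_iff_continuous_domRestrict.1 hf).Icc_extend'
  have hgf : ∀ t ∈ Icc a b, g t = f t := fun t ht => by
    rw [hg, IccExtend_of_mem hab _ ht]; rfl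
  set Z : ℝ → ℝ := fun t => ∫ s in a..t, g s
  have hZd : ∀ t, HasDerivAt Z (g t) t := fun t =>
    intervalIntegral.integral_hasDerivAt_right (hgc.intervalIntegrable _ _)
      hgc.stronglyMeasurable.stronglyMeasurableAtFilter hgc.continuousAt
  have hZf : ∀ t ∈ Icc a b, Z t = ∫ s in a..t, f s := fun t ht =>
    intervalIntegral.integral_congr fun s hs => by
      rw [uIcc_of_le ht.1] at hs
      exact hgf s ⟨hs.1, hs.2.trans ht.2⟩
  have hZ0 : ∀ t ∈ Icc a b, 0 ≤ Z t := fun t ht =>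
    intervalIntegral.integral_nonneg ht.1 fun s hs => by
      rw [hgf s ⟨hs.1, hs.2.trans ht.2⟩]; exact hf0 s ⟨hs.1, hs.2.trans ht.2⟩
  have key := norm_le_gronwallBound_of_norm_deriv_right_le (f := Z) (f' := g) (δ := 0) (K := K)
    (ε := A) (a := a) (b := b) (fun t _ => (hZd t).continuousAt.continuousWithinAt)
    (fun t _ => (hZd t).hasDerivWithinAt) (by simp [Z])
    (fun t ht => by
      have ht' : t ∈ Icc a b := Ico_subset_Icc_self ht
      rw [Real.norm_of_nonneg (hZ0 t ht'), hgf t ht', Real.norm_of_nonneg (hf0 t ht'), hZf t ht']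
      linarith [h t ht']) b (right_mem_Icc.2 hab)
  have hb := h b (right_mem_Icc.2 hab)
  rw [← hZf b (right_mem_Icc.2 hab)] at hb
  rw [Real.norm_of_nonneg (hZ0 b (right_mem_Icc.2 hab)), gronwallBound_of_K_ne_0 hK.ne'] at key
  have : K * (0 * Real.exp (K * (b - a)) + A / K * (Real.exp (K * (b - a)) - 1))
      = A * Real.exp (K * (b - a)) - A := by
    field_simp; ring
  nlinarith [mul_le_mul_of_nonneg_left key hK.le]

theorem intervalIntegrable_of_continuousOn_Icc {E : Type*} [NormedAddCommGroup E] {a b t : ℝ}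
    {f : ℝ → E} (hf : ContinuousOn f (Icc a b)) (ht : t ∈ Icc a b) :
    IntervalIntegrable f volume a t :=
  (hf.mono (by rw [uIcc_of_le ht.1]; exact Icc_subset_Icc_right ht.2)).intervalIntegrable

theorem intervalIntegrable_of_integrable_Icc {E : Type*} [NormedAddCommGroup E] {a b t : ℝ}
    {f : ℝ → E} (hf : Integrable f (volume.restrict (Icc a b))) (ht : t ∈ Icc a b) :
    IntervalIntegrable f volume a t :=
  IntegrableOn.intervalIntegrable
    (IntegrableOn.mono_set hf (by rw [uIcc_of_le ht.1]; exact Icc_subset_Icc_right ht.2))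

theorem integral_mono_upper {a s t : ℝ} {f : ℝ → ℝ} (has : a ≤ s) (hst : s ≤ t)
    (hf : IntervalIntegrable f volume a t) (h0 : ∀ r, 0 ≤ f r) :
    ∫ r in a..s, f r ≤ ∫ r in a..t, f r :=
  intervalIntegral.integral_mono_interval le_rfl has hst (Eventually.of_forall h0) hf

/-! ### The abstract energy estimate -/

section Hilbert

variable {H : Type*} [NormedAddCommGroup H] [InnerProductSpace ℝ H] {a b : ℝ}

theorem integrable_inner_of_continuousOn {F e : ℝ → H}
    (hF : Integrable F (volume.restrict (Icc a b))) (he : ContinuousOn e (Icc a b)) :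
    Integrable (fun s => inner ℝ (F s) (e s)) (volume.restrict (Icc a b)) := by
  obtain ⟨C, hC⟩ := isCompact_Icc.exists_bound_of_continuousOn he
  refine (hF.norm.mul_const C).mono'
    (hF.aestronglyMeasurable.inner (he.aestronglyMeasurable measurableSet_Icc)) ?_
  filter_upwards [ae_restrict_mem measurableSet_Icc] with s hs
  exact (norm_inner_le_norm _ _).trans (mul_le_mul_of_nonneg_left (hC s hs) (norm_nonneg _))

/-- An energy inequality with a small factor `ε` in front of the boundary term, integrated once
more in time. -/
theorem integral_norm_sq_le_add_double_integral {L K ε δ : ℝ} (hab : a ≤ b) (hL : 0 < L)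
    (hbL : b - a ≤ L) (hε : 0 < ε) (hδ : 4 * ε ≤ δ) {e e' F : ℝ → H}
    (he : ContinuousOn e (Icc a b)) (he' : ContinuousOn e' (Icc a b))
    (hF : Integrable F (volume.restrict (Icc a b)))
    (hF2 : Integrable (fun s => ‖F s‖ ^ 2) (volume.restrict (Icc a b)))
    (hE : ∀ t ∈ Icc a b, 1 / 2 * ‖e t‖ ^ 2 ≤ ε * inner ℝ (e' t) (e t)
      + K * (∫ s in a..t, ‖e s‖ ^ 2) + ε * ∫ s in a..t, inner ℝ (F s) (e s)) :
    ∫ s in a..b, ‖e s‖ ^ 2 ≤ 2 * ε * δ * (∫ s in a..b, ‖e' s‖ ^ 2)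
      + 8 * ε ^ 2 * L ^ 2 * (∫ s in a..b, ‖F s‖ ^ 2)
      + 4 * K * ∫ t in a..b, ∫ s in a..t, ‖e s‖ ^ 2 := by
  have hδ0 : 0 < δ := by linarith
  have hb : b ∈ Icc a b := right_mem_Icc.2 hab
  have hFe := integrable_inner_of_continuousOn hF he
  have he2 : ContinuousOn (fun s => ‖e s‖ ^ 2) (Icc a b) := he.norm.pow 2
  have he2' : ContinuousOn (fun s => ‖e' s‖ ^ 2) (Icc a b) := he'.norm.pow 2
  have hee : ContinuousOn (fun s => inner ℝ (e' s) (e s)) (Icc a b) := he'.inner he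
  set Y := ∫ s in a..b, ‖e s‖ ^ 2
  set P := ∫ s in a..b, ‖e' s‖ ^ 2
  set Q := ∫ s in a..b, ‖F s‖ ^ 2
  -- Young's inequality with weight `1 / (8 * L)`: integrating the constant `C` over an interval of
  -- length at most `L` then costs only `Y / 8`.
  set C : ℝ := 1 / (8 * L) * Y + 2 * L * ε ^ 2 * Q with hC
  have hsrc : ∀ t ∈ Icc a b, ε * ∫ s in a..t, inner ℝ (F s) (e s) ≤ C := by
    intro t ht
    rw [← intervalIntegral.integral_const_mul]
    have hi1 : IntervalIntegrable (fun s => 1 / (8 * L) * ‖e s‖ ^ 2) volume a t :=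
      (intervalIntegrable_of_continuousOn_Icc he2 ht).const_mul _
    have hi2 : IntervalIntegrable (fun s => 2 * L * ε ^ 2 * ‖F s‖ ^ 2) volume a t :=
      (intervalIntegrable_of_integrable_Icc hF2 ht).const_mul _
    calc ∫ s in a..t, ε * inner ℝ (F s) (e s)
        ≤ ∫ s in a..t, (1 / (8 * L) * ‖e s‖ ^ 2 + 2 * L * ε ^ 2 * ‖F s‖ ^ 2) := by
          refine intervalIntegral.integral_mono_on ht.1
            ((intervalIntegrable_of_integrable_Icc hFe ht).const_mul _) (hi1.add hi2) ?_
          intro s _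
          have h1 : ε * inner ℝ (F s) (e s) ≤ ε * (‖F s‖ * ‖e s‖) :=
            mul_le_mul_of_nonneg_left (real_inner_le_norm _ _) hε.le
          have h2 : 1 / (8 * L) * ‖e s‖ ^ 2 + 2 * L * ε ^ 2 * ‖F s‖ ^ 2 - ε * (‖F s‖ * ‖e s‖)
              = 1 / (8 * L) * (‖e s‖ - 4 * L * ε * ‖F s‖) ^ 2 := by
            field_simp; ring
          have h3 : 0 ≤ 1 / (8 * L) * (‖e s‖ - 4 * L * ε * ‖F s‖) ^ 2 := by positivity
          linarith
      _ = 1 / (8 * L) * (∫ s in a..t, ‖e s‖ ^ 2) + 2 * L * ε ^ 2 * ∫ s in a..t, ‖F s‖ ^ 2 := by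
          rw [intervalIntegral.integral_add hi1 hi2, intervalIntegral.integral_const_mul,
            intervalIntegral.integral_const_mul]
      _ ≤ C := by
          refine add_le_add ?_ ?_
          · exact mul_le_mul_of_nonneg_left (integral_mono_upper ht.1 ht.2
              (intervalIntegrable_of_continuousOn_Icc he2 hb) fun _ => by positivity)
              (by positivity)
          · exact mul_le_mul_of_nonneg_left (integral_mono_upper ht.1 ht.2
              (intervalIntegrable_of_integrable_Icc hF2 hb) fun _ => by positivity)
              (by positivity)
  have hYc : ContinuousOn (fun t => ∫ s in a..t, ‖e s‖ ^ 2) (Icc a b) := by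
    have h := intervalIntegral.continuousOn_primitive_interval'
      (intervalIntegrable_of_continuousOn_Icc he2 hb) left_mem_uIcc
    rwa [uIcc_of_le hab] at h
  have hYi := intervalIntegrable_of_continuousOn_Icc hYc hb
  have hi3 : IntervalIntegrable
      (fun t => ε * δ / 2 * ‖e' t‖ ^ 2 + 1 / 8 * ‖e t‖ ^ 2) volume a b :=
    ((intervalIntegrable_of_continuousOn_Icc he2' hb).const_mul _).add
      ((intervalIntegrable_of_continuousOn_Icc he2 hb).const_mul _)
  have hmain : ∫ t in a..b, 1 / 2 * ‖e t‖ ^ 2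
      ≤ ∫ t in a..b, ((ε * δ / 2 * ‖e' t‖ ^ 2 + 1 / 8 * ‖e t‖ ^ 2)
        + K * (∫ s in a..t, ‖e s‖ ^ 2) + C) := by
    refine intervalIntegral.integral_mono_on hab
      ((intervalIntegrable_of_continuousOn_Icc he2 hb).const_mul _)
      ((hi3.add (hYi.const_mul K)).add intervalIntegrable_const) ?_
    intro t ht
    have h1 : ε * inner ℝ (e' t) (e t) ≤ ε * (‖e' t‖ * ‖e t‖) :=
      mul_le_mul_of_nonneg_left (real_inner_le_norm _ _) hε.le
    -- The weight `δ` stays free so that the coefficient of `‖e'‖²` can later be made small; `4 * ε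
    -- ≤ δ` keeps the other coefficient below `1 / 8`.
    have h2 : ε * (‖e' t‖ * ‖e t‖) ≤ ε * δ / 2 * ‖e' t‖ ^ 2 + ε / (2 * δ) * ‖e t‖ ^ 2 := by
      have h3 : ε * δ / 2 * ‖e' t‖ ^ 2 + ε / (2 * δ) * ‖e t‖ ^ 2 - ε * (‖e' t‖ * ‖e t‖)
          = ε / (2 * δ) * (δ * ‖e' t‖ - ‖e t‖) ^ 2 := by
        field_simp; ring
      have h4 : 0 ≤ ε / (2 * δ) * (δ * ‖e' t‖ - ‖e t‖) ^ 2 := by positivity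
      linarith
    have h5 : ε / (2 * δ) * ‖e t‖ ^ 2 ≤ 1 / 8 * ‖e t‖ ^ 2 := by
      refine mul_le_mul_of_nonneg_right ?_ (by positivity)
      rw [div_le_div_iff₀ (by positivity) (by norm_num)]
      linarith
    linarith [hE t ht, hsrc t ht]
  rw [intervalIntegral.integral_const_mul, intervalIntegral.integral_add
    (hi3.add (hYi.const_mul K)) intervalIntegrable_const, intervalIntegral.integral_add hi3
    (hYi.const_mul K), intervalIntegral.integral_add
    ((intervalIntegrable_of_continuousOn_Icc he2' hb).const_mul _)
    ((intervalIntegrable_of_continuousOn_Icc he2 hb).const_mul _),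
    intervalIntegral.integral_const_mul, intervalIntegral.integral_const_mul,
    intervalIntegral.integral_const_mul, intervalIntegral.integral_const, smul_eq_mul] at hmain
  have hY0 : 0 ≤ Y := intervalIntegral.integral_nonneg hab fun _ _ => by positivity
  have hQ0 : 0 ≤ Q := intervalIntegral.integral_nonneg hab fun _ _ => by positivity
  have hC0 : 0 ≤ C := by positivity
  have hLC : (b - a) * C ≤ 1 / 8 * Y + 2 * L ^ 2 * ε ^ 2 * Q := by
    refine (mul_le_mul_of_nonneg_right hbL hC0).trans (le_of_eq ?_)
    rw [hC]; field_simp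
  -- Of `Y / 2` on the left, the boundary term and the source use `Y / 8` each. The remaining `Y /
  -- 4` explains the factor `4` in the conclusion.
  linarith

/-- For small `ε`, the time integral of `‖e‖²` is dominated by `ε` times the time integrals of
`‖e'‖²` and of `‖F‖²`. -/
theorem integral_norm_sq_le_of_energy {L K M ε : ℝ} (hab : a ≤ b) (hL : 0 < L)
    (hbL : b - a ≤ L) (hK : 0 < K) (hM : 0 < M) (hε : 0 < ε)
    (hε1 : ε ≤ 1 / (16 * M * Real.exp (4 * K * L)))
    (hε2 : ε ≤ 1 / (32 * L ^ 2 * M * Real.exp (4 * K * L))) {e e' F : ℝ → H}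
    (he : ContinuousOn e (Icc a b)) (he' : ContinuousOn e' (Icc a b))
    (hF : Integrable F (volume.restrict (Icc a b)))
    (hF2 : Integrable (fun s => ‖F s‖ ^ 2) (volume.restrict (Icc a b)))
    (hE : ∀ t ∈ Icc a b, 1 / 2 * ‖e t‖ ^ 2 ≤ ε * inner ℝ (e' t) (e t)
      + K * (∫ s in a..t, ‖e s‖ ^ 2) + ε * ∫ s in a..t, inner ℝ (F s) (e s)) :
    M * (∫ s in a..b, ‖e s‖ ^ 2)
      ≤ ε / 2 * (∫ s in a..b, ‖e' s‖ ^ 2) + ε / 4 * ∫ s in a..b, ‖F s‖ ^ 2 := by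
  set E := Real.exp (4 * K * L) with hEdef
  have hE0 : 0 < E := Real.exp_pos _
  have hb : b ∈ Icc a b := right_mem_Icc.2 hab
  have he2 : ContinuousOn (fun s => ‖e s‖ ^ 2) (Icc a b) := he.norm.pow 2
  have he2' : ContinuousOn (fun s => ‖e' s‖ ^ 2) (Icc a b) := he'.norm.pow 2
  set P := ∫ s in a..b, ‖e' s‖ ^ 2
  set Q := ∫ s in a..b, ‖F s‖ ^ 2
  have hP0 : 0 ≤ P := intervalIntegral.integral_nonneg hab fun _ _ => by positivity
  have hQ0 : 0 ≤ Q := intervalIntegral.integral_nonneg hab fun _ _ => by positivity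
  -- Chosen so that `M * (2 * ε * δ) * E = ε / 2`. The first smallness condition on `ε` is `4 * ε ≤
  -- δ`; the second brings the coefficient of `Q` down to `ε / 4`.
  set δ := 1 / (4 * M * E) with hδ
  have hδε : 4 * ε ≤ δ := by
    calc 4 * ε ≤ 4 * (1 / (16 * M * E)) := by linarith
      _ = δ := by rw [hδ]; field_simp; norm_num
  have hYc : ContinuousOn (fun t => ∫ s in a..t, ‖e s‖ ^ 2) (Icc a b) := by
    have h := intervalIntegral.continuousOn_primitive_interval'
      (intervalIntegrable_of_continuousOn_Icc he2 hb) left_mem_uIcc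
    rwa [uIcc_of_le hab] at h
  have key := le_mul_exp_of_le_add_integral (A := 2 * ε * δ * P + 8 * ε ^ 2 * L ^ 2 * Q)
    (K := 4 * K) hab (by positivity) hYc
    (fun t ht => intervalIntegral.integral_nonneg ht.1 fun _ _ => by positivity)
    (fun t ht => by
      have hsub : Icc a t ⊆ Icc a b := Icc_subset_Icc_right ht.2
      have hδ0 : 0 < δ := by positivity
      refine (integral_norm_sq_le_add_double_integral ht.1 hL (by linarith [ht.2]) hε hδε
        (he.mono hsub) (he'.mono hsub) (IntegrableOn.mono_set hF hsub)
        (IntegrableOn.mono_set hF2 hsub) (fun s hs => hE s (hsub hs))).trans ?_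
      refine add_le_add (add_le_add ?_ ?_) le_rfl
      · exact mul_le_mul_of_nonneg_left (integral_mono_upper ht.1 ht.2
          (intervalIntegrable_of_continuousOn_Icc he2' hb) fun _ => by positivity) (by positivity)
      · exact mul_le_mul_of_nonneg_left (integral_mono_upper ht.1 ht.2
          (intervalIntegrable_of_integrable_Icc hF2 hb) fun _ => by positivity) (by positivity))
  have hδ0 : 0 < δ := by positivity
  have hexp : Real.exp (4 * K * (b - a)) ≤ E :=
    Real.exp_le_exp.2 (mul_le_mul_of_nonneg_left hbL (by positivity))
  have h1 : ∫ s in a..b, ‖e s‖ ^ 2 ≤ (2 * ε * δ * P + 8 * ε ^ 2 * L ^ 2 * Q) * E :=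
    key.trans (mul_le_mul_of_nonneg_left hexp (by positivity))
  have h2 : M * ((2 * ε * δ * P + 8 * ε ^ 2 * L ^ 2 * Q) * E)
      = ε / 2 * P + (ε * (32 * L ^ 2 * M * E)) * (ε / 4 * Q) := by
    rw [hδ]; field_simp; ring
  have h3 : ε * (32 * L ^ 2 * M * E) ≤ 1 := by
    rwa [le_div_iff₀ (by positivity)] at hε2
  have h4 : (ε * (32 * L ^ 2 * M * E)) * (ε / 4 * Q) ≤ 1 * (ε / 4 * Q) :=
    mul_le_mul_of_nonneg_right h3 (by positivity)
  linarith [mul_le_mul_of_nonneg_left h1 hM.le]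

/-- A threshold for the perturbation parameter, in terms of the length `L` of the time interval,
the ellipticity constant `α₀` and a bound `B` for the convection field. -/
noncomputable def perturbationThreshold (L α₀ B : ℝ) : ℝ :=
  -- The first summand is the Young constant for the convection term; the `1` makes `K` positive
  -- even for `B = 0`, as Grönwall requires. In `M`, the summands pay for `K∫‖e‖²`, for completing
  -- `∫ d²` to the full `V` norm, and for the source.
  let K := B ^ 2 / (2 * α₀) + 1
  let M := K + α₀ / 2 + 1
  let E := Real.exp (4 * K * L)
  min 1 (min (1 / (16 * M * E)) (1 / (32 * L ^ 2 * M * E)))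

theorem perturbationThreshold_pos {L α₀ : ℝ} (B : ℝ) (hL : 0 < L) (hα₀ : 0 < α₀) :
    0 < perturbationThreshold L α₀ B := by
  unfold perturbationThreshold
  have := Real.exp_pos (4 * (B ^ 2 / (2 * α₀) + 1) * L)
  exact lt_min one_pos (lt_min (by positivity) (by positivity))

/-- The energy estimate in a Hilbert space for a function `e` with `e a = 0` that satisfies
`⟨e' - ε (e'' + F), e⟩ + α₀ d² ≤ B d ‖e‖` at almost every time. -/
theorem energy_estimate [CompleteSpace H] {L α₀ B ε : ℝ} (hab : a ≤ b) (hL : 0 < L)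
    (hbL : b - a ≤ L) (hα₀ : 0 < α₀) (hε : 0 < ε) (hεB : ε < perturbationThreshold L α₀ B)
    {e e' e'' F : ℝ → H} {d : ℝ → ℝ}
    (hd : MemLp d 2 (volume.restrict (Icc a b)))
    (he'' : Integrable e'' (volume.restrict (Icc a b)))
    (hF : MemLp F 2 (volume.restrict (Icc a b)))
    (he0 : e a = 0) (he : ∀ t ∈ Icc a b, e t = e a + ∫ s in a..t, e' s)
    (he' : ∀ t ∈ Icc a b, e' t = e' a + ∫ s in a..t, e'' s)
    (hineq : ∀ᵐ s ∂volume.restrict (Icc a b),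
      inner ℝ (e' s) (e s) - ε * inner ℝ (e'' s) (e s) - ε * inner ℝ (F s) (e s)
        + α₀ * d s ^ 2 ≤ B * d s * ‖e s‖) :
    1 / 2 * ‖e b‖ ^ 2
        + α₀ / 2 * ((∫ s in a..b, ‖e s‖ ^ 2) + ∫ s in a..b, d s ^ 2)
        + ε / 2 * (∫ s in a..b, ‖e' s‖ ^ 2)
      ≤ ε / 2 * (∫ s in a..b, ‖F s‖ ^ 2) + ε * inner ℝ (e' b) (e b) := by
  set K := B ^ 2 / (2 * α₀) + 1 with hK
  have hK0 : 0 < K := by positivity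
  have hb : b ∈ Icc a b := right_mem_Icc.2 hab
  have hcont' : ContinuousOn e' (Icc a b) :=
    continuousOn_of_eq_add_integral hab (intervalIntegrable_of_integrable_Icc he'' hb) he'
  have hcont : ContinuousOn e (Icc a b) :=
    continuousOn_of_eq_add_integral hab (intervalIntegrable_of_continuousOn_Icc hcont' hb) he
  have hF1 : Integrable F (volume.restrict (Icc a b)) := hF.integrable (by norm_num)
  have hF2 : Integrable (fun s => ‖F s‖ ^ 2) (volume.restrict (Icc a b)) :=
    hF.integrable_norm_pow (by norm_num)
  have hd2 : Integrable (fun s => d s ^ 2) (volume.restrict (Icc a b)) := hd.integrable_sq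
  have he2 : ContinuousOn (fun s => ‖e s‖ ^ 2) (Icc a b) := hcont.norm.pow 2
  have he2' : ContinuousOn (fun s => ‖e' s‖ ^ 2) (Icc a b) := hcont'.norm.pow 2
  have hee : ContinuousOn (fun s => inner ℝ (e' s) (e s)) (Icc a b) := hcont'.inner hcont
  have hFe := integrable_inner_of_continuousOn hF1 hcont
  have he''e := integrable_inner_of_continuousOn he'' hcont
  have hE : ∀ t ∈ Icc a b, 1 / 2 * ‖e t‖ ^ 2 + α₀ / 2 * (∫ s in a..t, d s ^ 2)
      + ε * (∫ s in a..t, ‖e' s‖ ^ 2) ≤ ε * inner ℝ (e' t) (e t)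
      + K * (∫ s in a..t, ‖e s‖ ^ 2) + ε * ∫ s in a..t, inner ℝ (F s) (e s) := by
    intro t ht
    have hsub : Icc a t ⊆ Icc a b := Icc_subset_Icc_right ht.2
    have i1 := intervalIntegrable_of_continuousOn_Icc hee ht
    have i2 := intervalIntegrable_of_integrable_Icc he''e ht
    have i3 := intervalIntegrable_of_integrable_Icc hFe ht
    have i4 := intervalIntegrable_of_integrable_Icc hd2 ht
    have i5 := intervalIntegrable_of_continuousOn_Icc he2 ht
    have i6 := intervalIntegrable_of_continuousOn_Icc he2' ht
    have ibp1 := integral_inner_add_inner_eq_sub ht.1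
      (intervalIntegrable_of_continuousOn_Icc hcont' ht)
      (intervalIntegrable_of_continuousOn_Icc hcont' ht)
      (fun s hs => he s (hsub hs)) (fun s hs => he s (hsub hs))
    have ibp2 := integral_inner_add_inner_eq_sub ht.1
      (intervalIntegrable_of_integrable_Icc he'' ht)
      (intervalIntegrable_of_continuousOn_Icc hcont' ht)
      (fun s hs => he' s (hsub hs)) (fun s hs => he s (hsub hs))
    simp only [he0, inner_zero_right, sub_zero, real_inner_self_eq_norm_sq,
      fun s => real_inner_comm (e' s) (e s)] at ibp1 ibp2
    rw [intervalIntegral.integral_add i6 i2] at ibp2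
    rw [intervalIntegral.integral_add i1 i1] at ibp1
    -- Half of `α₀ d²` absorbs the convection term, at the price of `K‖e‖²`.
    have hle : ∫ s in a..t, (inner ℝ (e' s) (e s) - ε * inner ℝ (e'' s) (e s)
        - ε * inner ℝ (F s) (e s) + α₀ / 2 * d s ^ 2 - K * ‖e s‖ ^ 2) ≤ ∫ _ in a..t, (0 : ℝ) := by
      refine intervalIntegral.integral_mono_ae_restrict ht.1
        ((((i1.sub (i2.const_mul ε)).sub (i3.const_mul ε)).add (i4.const_mul _)).sub
          (i5.const_mul K)) intervalIntegrable_const ?_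
      filter_upwards [ae_restrict_of_ae_restrict_of_subset hsub hineq] with s hs
      have h1 : α₀ / 2 * d s ^ 2 + B ^ 2 / (2 * α₀) * ‖e s‖ ^ 2 - B * d s * ‖e s‖
          = 1 / (2 * α₀) * (α₀ * d s - B * ‖e s‖) ^ 2 := by
        field_simp; ring
      have h2 : 0 ≤ 1 / (2 * α₀) * (α₀ * d s - B * ‖e s‖) ^ 2 := by positivity
      have h3 : K * ‖e s‖ ^ 2 = B ^ 2 / (2 * α₀) * ‖e s‖ ^ 2 + ‖e s‖ ^ 2 := by rw [hK]; ring
      have h4 : 0 ≤ ‖e s‖ ^ 2 := by positivity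
      linarith
    rw [intervalIntegral.integral_sub (((i1.sub (i2.const_mul ε)).sub (i3.const_mul ε)).add
        (i4.const_mul _)) (i5.const_mul K),
      intervalIntegral.integral_add ((i1.sub (i2.const_mul ε)).sub (i3.const_mul ε))
        (i4.const_mul _), intervalIntegral.integral_sub (i1.sub (i2.const_mul ε))
        (i3.const_mul ε), intervalIntegral.integral_sub i1 (i2.const_mul ε),
      intervalIntegral.integral_const_mul, intervalIntegral.integral_const_mul,
      intervalIntegral.integral_const_mul, intervalIntegral.integral_const_mul,
      intervalIntegral.integral_zero] at hle
    linear_combination hle + ε * ibp2 - (1 / 2) * ibp1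
  have hnn : ∀ t ∈ Icc a b, 0 ≤ α₀ / 2 * (∫ s in a..t, d s ^ 2)
      + ε * (∫ s in a..t, ‖e' s‖ ^ 2) := fun t ht => by
    have h1 : 0 ≤ ∫ s in a..t, d s ^ 2 :=
      intervalIntegral.integral_nonneg ht.1 fun _ _ => by positivity
    have h2 : 0 ≤ ∫ s in a..t, ‖e' s‖ ^ 2 :=
      intervalIntegral.integral_nonneg ht.1 fun _ _ => by positivity
    positivity
  obtain ⟨hε1, hε2, hε3⟩ : ε < 1 ∧ _ ∧ _ := by
    simpa only [perturbationThreshold, lt_min_iff] using hεB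
  -- This consumes half of `ε∫‖e'‖²` and `ε / 4` of `∫‖F‖²`. The source term `hsrc` adds another `ε
  -- / 4`, for a total of `ε / 2`.
  have hsmall := integral_norm_sq_le_of_energy (M := K + α₀ / 2 + 1) hab hL hbL hK0
    (by positivity) hε hε2.le hε3.le hcont hcont' hF1 hF2
    (fun t ht => by linarith [hE t ht, hnn t ht])
  have hsrc : ε * ∫ s in a..b, inner ℝ (F s) (e s)
      ≤ ε * (∫ s in a..b, ‖e s‖ ^ 2) + ε / 4 * ∫ s in a..b, ‖F s‖ ^ 2 := by
    have i1 := (intervalIntegrable_of_continuousOn_Icc he2 hb).const_mul ε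
    have i2 := (intervalIntegrable_of_integrable_Icc hF2 hb).const_mul (ε / 4)
    rw [← intervalIntegral.integral_const_mul, ← intervalIntegral.integral_const_mul,
      ← intervalIntegral.integral_const_mul, ← intervalIntegral.integral_add i1 i2]
    refine intervalIntegral.integral_mono_on hab
      ((intervalIntegrable_of_integrable_Icc hFe hb).const_mul ε) (i1.add i2) fun s _ => ?_
    have h1 := mul_le_mul_of_nonneg_left (real_inner_le_norm (F s) (e s)) hε.le
    have h2 : 0 ≤ ε * (‖e s‖ - 1 / 2 * ‖F s‖) ^ 2 := by positivity
    linarith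
  have hY0 : 0 ≤ ∫ s in a..b, ‖e s‖ ^ 2 :=
    intervalIntegral.integral_nonneg hab fun _ _ => by positivity
  have hεY : ε * (∫ s in a..b, ‖e s‖ ^ 2) ≤ 1 * ∫ s in a..b, ‖e s‖ ^ 2 :=
    mul_le_mul_of_nonneg_right hε1.le hY0
  linarith [hE b hb]

end Hilbert

/-! ### The coderivative of a test form -/

theorem contDiff_pd {g : Pt → ℝ} (hg : ContDiff ℝ ∞ g) (j : Fin 3) : ContDiff ℝ ∞ (pd j g) :=
  (hg.fderiv_right (m := ∞) (by norm_cast)).clm_apply contDiff_const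

theorem contDiff_coD {k : ℕ} {φ : Pt → Form (k + 1)} (hφ : ContDiff ℝ ∞ φ) :
    ContDiff ℝ ∞ (coD k φ) := by
  have hc := contDiff_euclidean.1 hφ
  match k, φ, hc with
  | 0, φ, hc =>
    refine contDiff_euclidean.2 fun i => ?_
    fin_cases i
    exact (((contDiff_pd (hc 0) 0).add (contDiff_pd (hc 1) 1)).add (contDiff_pd (hc 2) 2)).neg
  | 1, φ, hc =>
    refine contDiff_euclidean.2 fun i => ?_
    fin_cases i
    · exact (contDiff_pd (hc 2) 1).sub (contDiff_pd (hc 1) 2)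
    · exact (contDiff_pd (hc 0) 2).sub (contDiff_pd (hc 2) 0)
    · exact (contDiff_pd (hc 1) 0).sub (contDiff_pd (hc 0) 1)
  | 2, φ, hc =>
    refine contDiff_euclidean.2 fun i => ?_
    fin_cases i
    · exact (contDiff_pd (hc 0) 0).neg
    · exact (contDiff_pd (hc 0) 1).neg
    · exact (contDiff_pd (hc 0) 2).neg
  | k + 3, φ, hc => exact contDiff_const

theorem pd_eq_zero_of_eventuallyEq {g : Pt → ℝ} {x : Pt} (hg : g =ᶠ[𝓝 x] fun _ => 0)
    (j : Fin 3) : pd j g x = 0 := by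
  simp [pd, hg.fderiv_eq]

theorem coD_eq_zero_of_eventuallyEq {k : ℕ} {φ : Pt → Form (k + 1)} {x : Pt}
    (hφ : φ =ᶠ[𝓝 x] fun _ => 0) : coD k φ x = 0 := by
  have hc : ∀ i j, pd j (fun y => φ y i) x = 0 := fun i j =>
    pd_eq_zero_of_eventuallyEq (hφ.mono fun y hy => by simp [hy]) j
  match k, φ, hc with
  | 0, φ, hc =>
    ext i
    fin_cases i
    simp [coD, divF, hc]
  | 1, φ, hc =>
    ext i
    fin_cases i <;> simp [coD, curlF, hc]
  | 2, φ, hc =>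
    ext i
    fin_cases i <;> simp [coD, gradF, hc]
  | k + 3, φ, hc => rfl

/-- A differential operator with constant coefficients preserves smoothness and does not enlarge
supports. -/
theorem IsTest.coD {k : ℕ} {Ω : Set Pt} {φ : Pt → Form (k + 1)} (hφ : IsTest (k + 1) Ω φ) :
    IsTest k Ω (coD k φ) := by
  have hsub : tsupport (SpaceTimeCD.coD k φ) ⊆ tsupport φ := by
    refine closure_minimal (fun x hx => ?_) (isClosed_tsupport φ)
    by_contra h
    exact hx (coD_eq_zero_of_eventuallyEq (notMem_tsupport_iff_eventuallyEq.1 h))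
  exact ⟨contDiff_coD hφ.smooth, hφ.compact.of_isClosed_subset (isClosed_tsupport _) hsub,
    hsub.trans hφ.support⟩

/-- Co-closedness is tested against `extD k ψ`; here `ψ = coD k φ`. This removes the perturbation `ε
dδu` from the weak equation. -/
theorem pair_dCoD_eq_zero {k : ℕ} {Ω : Set Pt} {w : L2 k Ω} (hw : CoClosed k Ω w)
    {φ : Pt → Form k} (hφ : IsTest k Ω φ) : pair w (dCoD k φ) = 0 := by
  match k, w, hw, φ, hφ with
  | 0, w, hw, φ, hφ => simp [pair, dCoD]
  | k + 1, w, hw, φ, hφ => exact hw _ hφ.coD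

/-! ### The product with the convection field -/

theorem norm_sq_fin_one (v : EuclideanSpace ℝ (Fin 1)) : ‖v‖ ^ 2 = v 0 ^ 2 := by
  simp [EuclideanSpace.norm_sq_eq]

theorem norm_sq_fin_three (v : EuclideanSpace ℝ (Fin 3)) :
    ‖v‖ ^ 2 = v 0 ^ 2 + v 1 ^ 2 + v 2 ^ 2 := by
  simp [EuclideanSpace.norm_sq_eq, Fin.sum_univ_three]

/-- Lagrange's identity `|b × u|² + (b · u)² = |b|² |u|²` covers both the cross and the dot product.
The constant `1` is what lets `betaSup` bound the convection term. -/
theorem norm_wedge_le (k : ℕ) (b : Pt) (u : Form k) : ‖wedge k b u‖ ≤ ‖b‖ * ‖u‖ := by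
  refine le_of_sq_le_sq ?_ (by positivity)
  rw [mul_pow]
  match k, u with
  | 0, u =>
    rw [norm_sq_fin_one u]
    change ‖u (0 : Fin 1) • b‖ ^ 2 ≤ _
    rw [norm_smul, mul_pow, Real.norm_eq_abs, sq_abs, mul_comm]
  | 1, u =>
    rw [norm_sq_fin_three b, norm_sq_fin_three u]
    refine (norm_sq_fin_three _).trans_le ?_
    simp only [wedge, PiLp.toLp_apply, Matrix.cons_val_zero, Matrix.cons_val_one, Matrix.cons_val]
    linarith [sq_nonneg (b 0 * u (0 : Fin 3) + b 1 * u (1 : Fin 3) + b 2 * u (2 : Fin 3))]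
  | 2, u =>
    rw [norm_sq_fin_three b, norm_sq_fin_three u]
    refine (norm_sq_fin_one _).trans_le ?_
    simp only [wedge, PiLp.toLp_apply, Matrix.cons_val_zero]
    linarith [sq_nonneg (b 0 * u (1 : Fin 3) - b 1 * u (0 : Fin 3)),
      sq_nonneg (b 0 * u (2 : Fin 3) - b 2 * u (0 : Fin 3)),
      sq_nonneg (b 1 * u (2 : Fin 3) - b 2 * u (1 : Fin 3))]
  | k + 3, u =>
    change ‖(0 : Form (k + 4))‖ ^ 2 ≤ _
    rw [norm_zero, zero_pow two_ne_zero]; positivity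

theorem wedge_sub (k : ℕ) (b : Pt) (u v : Form k) :
    wedge k b (u - v) = wedge k b u - wedge k b v := by
  match k, u, v with
  | 0, u, v => exact sub_smul _ _ _
  | 1, u, v =>
    ext i
    fin_cases i <;> simp [wedge] <;> ring
  | 2, u, v =>
    ext i
    fin_cases i
    simp [wedge]; ring
  | k + 3, u, v => exact (sub_zero _).symm

theorem continuous_wedge (k : ℕ) : Continuous fun p : Pt × Form k => wedge k p.1 p.2 := by
  have hb : ∀ i, Continuous fun p : Pt × Form k => p.1 i := fun i => by fun_prop
  have hu : ∀ i, Continuous fun p : Pt × Form k => p.2 i := fun i => by fun_prop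
  match k, hb, hu with
  | 0, hb, hu => exact (hu (0 : Fin 1)).smul continuous_fst
  | 1, hb, hu =>
    refine (PiLp.continuous_toLp 2 _).comp (continuous_pi fun i => ?_)
    fin_cases i
    · exact ((hb 1).mul (hu 2)).sub ((hb 2).mul (hu 1))
    · exact ((hb 2).mul (hu 0)).sub ((hb 0).mul (hu 2))
    · exact ((hb 0).mul (hu 1)).sub ((hb 1).mul (hu 0))
  | 2, hb, hu =>
    refine (PiLp.continuous_toLp 2 _).comp (continuous_pi fun i => ?_)
    fin_cases i
    exact (((hb 0).mul (hu 0)).add ((hb 1).mul (hu 1))).add ((hb 2).mul (hu 2))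
  | k + 3, hb, hu => exact continuous_const

variable {k : ℕ} {Ω : Set Pt} {t₀ T α₀ : ℝ}

/-! ### The space `V` -/

/-- `V.val` as a continuous linear map. -/
noncomputable def V.valL (k : ℕ) (Ω : Set Pt) : V k Ω →L[ℝ] L2 k Ω :=
  (WithLp.fstL 2 ℝ (L2 k Ω) (L2 (k + 1) Ω)).comp (Submodule.subtypeL _)

/-- `V.d` as a continuous linear map. -/
noncomputable def V.dL (k : ℕ) (Ω : Set Pt) : V k Ω →L[ℝ] L2 (k + 1) Ω :=
  (WithLp.sndL 2 ℝ (L2 k Ω) (L2 (k + 1) Ω)).comp (Submodule.subtypeL _)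

theorem V.valL_apply (v : V k Ω) : V.valL k Ω v = v.val := rfl

theorem V.val_sub (u v : V k Ω) : (u - v).val = u.val - v.val := (V.valL k Ω).map_sub u v

theorem V.d_sub (u v : V k Ω) : (u - v).d = u.d - v.d := (V.dL k Ω).map_sub u v

theorem V.norm_sq_eq (v : V k Ω) : ‖v‖ ^ 2 = ‖v.val‖ ^ 2 + ‖v.d‖ ^ 2 :=
  WithLp.prod_norm_sq_eq_of_L2 _

theorem V.norm_val_le (v : V k Ω) : ‖v.val‖ ≤ ‖v‖ := by
  refine le_of_sq_le_sq ?_ (norm_nonneg _)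
  rw [V.norm_sq_eq]
  linarith [sq_nonneg ‖v.d‖]

theorem pair_eq_inner {a p : L2 k Ω} {φ : Pt → Form k}
    (h : (p : Pt → Form k) =ᵐ[volume.restrict Ω] φ) : pair a φ = inner ℝ a p :=
  integral_congr_ae (h.mono fun x hx => by simp only [hx])

/-- A weak identity against test forms extends to all elements of `V` by density. -/
theorem V.inner_add_inner_eq_zero {a : L2 k Ω} {W : L2 (k + 1) Ω}
    (h : ∀ (φ : Pt → Form k) (p : L2 k Ω) (q : L2 (k + 1) Ω), IsTest k Ω φ →
      (p : Pt → Form k) =ᵐ[volume.restrict Ω] φ →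
      (q : Pt → Form (k + 1)) =ᵐ[volume.restrict Ω] extD k φ →
      inner ℝ a p + inner ℝ W q = 0) (v : V k Ω) :
    inner ℝ a v.val + inner ℝ W v.d = 0 := by
  set ℓ : WithLp 2 (L2 k Ω × L2 (k + 1) Ω) →L[ℝ] ℝ :=
    (innerSL ℝ a).comp (WithLp.fstL 2 ℝ _ _) + (innerSL ℝ W).comp (WithLp.sndL 2 ℝ _ _)
  -- The identity says that the continuous functional `ℓ` vanishes on the test graph. Its kernel is
  -- a closed subspace, hence contains `V`.
  have hker : (Submodule.span ℝ (testGraph k Ω)).topologicalClosure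
      ≤ LinearMap.ker ℓ.toLinearMap := by
    refine Submodule.topologicalClosure_minimal _ (Submodule.span_le.2 ?_) ℓ.isClosed_ker
    rintro w ⟨φ, hφ, h1, h2⟩
    exact h φ w.fst w.snd hφ h1 h2
  exact hker v.2

/-! ### The flux at a fixed time -/

/-- The flux `α du + β ∧ u` at time `t`. -/
noncomputable def Data.flux (D : Data k t₀ T α₀) (t : ℝ) (v : V k D.Ω) (x : Pt) : Form (k + 1) :=
  D.α t x • (v.d : Pt → Form (k + 1)) x + wedge k (D.β t x) ((v.val : Pt → Form k) x)

theorem Data.betaSup_nonneg (D : Data k t₀ T α₀) : 0 ≤ D.betaSup := ENNReal.toReal_nonneg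

/-- At almost every time the coefficients are essentially bounded in space. -/
theorem Data.ae_coefficients (D : Data k t₀ T α₀) :
    ∀ᵐ t ∂(volume.restrict (Icc t₀ T)),
      MemLp (D.α t) ∞ (volume.restrict D.Ω) ∧
      AEStronglyMeasurable (D.β t) (volume.restrict D.Ω) ∧
      (∀ᵐ x ∂(volume.restrict D.Ω), ‖D.β t x‖ ≤ D.betaSup) ∧
      ∀ᵐ x ∂(volume.restrict D.Ω), α₀ ≤ D.α t x := by
  have bound : ∀ {E : Type} [NormedAddCommGroup E] {g : ℝ × Pt → E},
      MemLp g ∞ ((volume.restrict (Icc t₀ T)).prod (volume.restrict D.Ω)) →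
      ∀ᵐ p ∂((volume.restrict (Icc t₀ T)).prod (volume.restrict D.Ω)), ‖g p‖ ≤
        (eLpNorm g ∞ ((volume.restrict (Icc t₀ T)).prod (volume.restrict D.Ω))).toReal := by
    intro E _ g hg
    have h := ae_le_eLpNormEssSup (f := g)
      (μ := (volume.restrict (Icc t₀ T)).prod (volume.restrict D.Ω))
    filter_upwards [h] with p hp
    rw [← eLpNorm_exponent_top] at hp
    have := ENNReal.toReal_mono hg.eLpNorm_lt_top.ne hp
    rwa [toReal_enorm] at this
  filter_upwards [D.α_mem.1.prodMk_left, Measure.ae_ae_of_ae_prod (bound D.α_mem),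
    D.β_mem.1.prodMk_left, Measure.ae_ae_of_ae_prod (bound D.β_mem),
    Measure.ae_ae_of_ae_prod D.α_ge] with t h1 h2 h3 h4 h5
  exact ⟨memLp_top_of_bound h1 _ h2, h3, h4, h5⟩

theorem memLp_wedge {b : Pt → Pt} {B : ℝ} (hb : AEStronglyMeasurable b (volume.restrict Ω))
    (hB : ∀ᵐ x ∂(volume.restrict Ω), ‖b x‖ ≤ B) (u : L2 k Ω) :
    MemLp (fun x => wedge k (b x) (u x)) 2 (volume.restrict Ω) := by
  refine MemLp.of_le_mul (c := B) (Lp.memLp u)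
    ((continuous_wedge k).comp_aestronglyMeasurable (hb.prodMk (Lp.aestronglyMeasurable u))) ?_
  filter_upwards [hB] with x hx
  exact (norm_wedge_le k _ _).trans (mul_le_mul_of_nonneg_right hx (norm_nonneg _))

theorem memLp_smul {a : Pt → ℝ} (ha : MemLp a ∞ (volume.restrict Ω)) (w : L2 k Ω) :
    MemLp (fun x => a x • w x) 2 (volume.restrict Ω) :=
  (Lp.memLp w).smul ha

/-- At almost every time the flux is square integrable, additive and coercive. -/
theorem Data.ae_flux (D : Data k t₀ T α₀) :
    ∀ᵐ t ∂(volume.restrict (Icc t₀ T)),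
      (∀ v, MemLp (D.flux t v) 2 (volume.restrict D.Ω)) ∧
      ∀ v (h : MemLp (D.flux t v) 2 (volume.restrict D.Ω)),
        α₀ * ‖v.d‖ ^ 2 ≤ inner ℝ (h.toLp (D.flux t v)) v.d + D.betaSup * ‖v.d‖ * ‖v.val‖ := by
  filter_upwards [D.ae_coefficients] with t ⟨hα, hβ, hB, hα₀⟩
  have hmem : ∀ v, MemLp (D.flux t v) 2 (volume.restrict D.Ω) := fun v =>
    (memLp_smul hα v.d).add (memLp_wedge hβ hB v.val)
  refine ⟨hmem, fun v h => ?_⟩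
  set A := (memLp_smul hα v.d).toLp _
  set W := (memLp_wedge hβ hB v.val).toLp _
  have hsum : h.toLp (D.flux t v) = A + W := MemLp.toLp_add _ _
  have hW : ‖W‖ ≤ D.betaSup * ‖v.val‖ := by
    refine Lp.norm_le_mul_norm_of_ae_le_mul ?_
    filter_upwards [hB, (memLp_wedge hβ hB v.val).coeFn_toLp] with x hx hWx
    rw [hWx]
    exact (norm_wedge_le k _ _).trans (mul_le_mul_of_nonneg_right hx (norm_nonneg _))
  have hA : α₀ * ‖v.d‖ ^ 2 ≤ inner ℝ A v.d := by
    rw [← real_inner_self_eq_norm_sq, L2.inner_def, L2.inner_def, ← integral_const_mul]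
    refine integral_mono_ae ((L2.integrable_inner v.d v.d).const_mul α₀)
      (L2.integrable_inner A v.d) ?_
    filter_upwards [hα₀, (memLp_smul hα v.d).coeFn_toLp] with x hx hAx
    rw [hAx, real_inner_smul_left]
    exact mul_le_mul_of_nonneg_right hx real_inner_self_nonneg
  have hWd : -(D.betaSup * ‖v.d‖ * ‖v.val‖) ≤ inner ℝ W v.d := by
    have h1 := (abs_le.1 (abs_real_inner_le_norm W v.d)).1
    have h2 := mul_le_mul_of_nonneg_right hW (norm_nonneg v.d)
    linarith
  rw [hsum, inner_add_left]
  linarith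

theorem Data.flux_sub (D : Data k t₀ T α₀) (t : ℝ) (u v : V k D.Ω) :
    D.flux t (u - v) =ᵐ[volume.restrict D.Ω] D.flux t u - D.flux t v := by
  filter_upwards [Lp.coeFn_sub u.val v.val, Lp.coeFn_sub u.d v.d] with x h1 h2
  simp only [Data.flux, Pi.sub_apply, V.val_sub, V.d_sub, h1, h2, wedge_sub, smul_sub]
  abel

theorem Data.spatial_eq_pair (D : Data k t₀ T α₀) {t : ℝ} {v : V k D.Ω}
    (h : MemLp (D.flux t v) 2 (volume.restrict D.Ω)) (φ : Pt → Form k) :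
    D.spatial t v φ = pair (h.toLp _) (extD k φ) :=
  integral_congr_ae (h.coeFn_toLp.mono fun x hx => by simp only [hx]; rfl)

/-! ### The difference of the two solutions -/

/-- The pointwise energy inequality for the difference of a perturbed and a limit solution. -/
theorem ae_energy_inequality (D : Data k t₀ T α₀) {ε : ℝ} {U₀ Uε : Trajectory k D.Ω}
    (h₀ : IsLimitSolution D U₀) (hε : IsPerturbedSolution D ε Uε) :
    ∀ᵐ t ∂(volume.restrict (Icc t₀ T)),
      inner ℝ (Uε.ut t - U₀.ut t).val (Uε.u t - U₀.u t).val
        - ε * inner ℝ (Uε.utt t - U₀.utt t) (Uε.u t - U₀.u t).val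
        - ε * inner ℝ (U₀.utt t) (Uε.u t - U₀.u t).val + α₀ * ‖(Uε.u t - U₀.u t).d‖ ^ 2
      ≤ D.betaSup * ‖(Uε.u t - U₀.u t).d‖ * ‖(Uε.u t - U₀.u t).val‖ := by
  filter_upwards [h₀.equation, hε.equation, hε.coclosed, D.ae_flux] with t e₀ eε hco ⟨hmem, hcoer⟩
  set e := Uε.u t - U₀.u t with he
  have hW : (hmem e).toLp (D.flux t e)
      = (hmem (Uε.u t)).toLp (D.flux t (Uε.u t)) - (hmem (U₀.u t)).toLp (D.flux t (U₀.u t)) := by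
    rw [← MemLp.toLp_sub]
    exact MemLp.toLp_congr _ _ (D.flux_sub t _ _)
  -- Only `Uε.utt` enters, since the limit equation has no second time derivative. It is split below
  -- as `e'' + U₀.utt`, which makes `U₀.utt` the source of the error equation.
  have key := V.inner_add_inner_eq_zero
    (a := (Uε.ut t - U₀.ut t).val - ε • Uε.utt t) (W := (hmem e).toLp (D.flux t e))
    (fun φ p q hφ hp hq => by
      have e1 := e₀ φ hφ
      have e2 := eε φ hφ
      rw [pair_dCoD_eq_zero hco hφ] at e2
      simp only [D.spatial_eq_pair (hmem _), pair_eq_inner hp, pair_eq_inner hq] at e1 e2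
      rw [hW, V.val_sub, inner_sub_left, inner_sub_left, inner_sub_left, real_inner_smul_left]
      linarith) e
  have hc := hcoer e (hmem e)
  rw [inner_sub_left, real_inner_smul_left] at key
  rw [inner_sub_left (Uε.utt t)]
  linarith

/-- A bound for a primitive that vanishes at the left end point. -/
theorem norm_sq_le_of_eq_integral {H : Type*} [NormedAddCommGroup H] [InnerProductSpace ℝ H]
    [CompleteSpace H] {a b η : ℝ} (hη : 0 < η) {e e' : ℝ → H} (he0 : e a = 0)
    (he' : ContinuousOn e' (Icc a b)) (he : ∀ t ∈ Icc a b, e t = e a + ∫ s in a..t, e' s)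
    {t : ℝ} (ht : t ∈ Icc a b) :
    ‖e t‖ ^ 2 ≤ η * (∫ s in a..b, ‖e' s‖ ^ 2) + 1 / η * ∫ s in a..b, ‖e s‖ ^ 2 := by
  have hab : a ≤ b := ht.1.trans ht.2
  have hb : b ∈ Icc a b := right_mem_Icc.2 hab
  have hsub : Icc a t ⊆ Icc a b := Icc_subset_Icc_right ht.2
  have hec : ContinuousOn e (Icc a b) :=
    continuousOn_of_eq_add_integral hab (intervalIntegrable_of_continuousOn_Icc he' hb) he
  have he2 : ContinuousOn (fun s => ‖e s‖ ^ 2) (Icc a b) := hec.norm.pow 2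
  have he2' : ContinuousOn (fun s => ‖e' s‖ ^ 2) (Icc a b) := he'.norm.pow 2
  have hee : ContinuousOn (fun s => inner ℝ (e s) (e' s) + inner ℝ (e' s) (e s)) (Icc a b) :=
    (hec.inner he').add (he'.inner hec)
  have ibp := integral_inner_add_inner_eq_sub ht.1
    (intervalIntegrable_of_continuousOn_Icc he' ht) (intervalIntegrable_of_continuousOn_Icc he' ht)
    (fun s hs => he s (hsub hs)) (fun s hs => he s (hsub hs))
  rw [he0, inner_zero_left, sub_zero, real_inner_self_eq_norm_sq] at ibp
  have i1 := (intervalIntegrable_of_continuousOn_Icc he2' ht).const_mul η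
  have i2 := (intervalIntegrable_of_continuousOn_Icc he2 ht).const_mul (1 / η)
  calc ‖e t‖ ^ 2 = ∫ s in a..t, (inner ℝ (e s) (e' s) + inner ℝ (e' s) (e s)) := ibp.symm
    _ ≤ ∫ s in a..t, (η * ‖e' s‖ ^ 2 + 1 / η * ‖e s‖ ^ 2) := by
        refine intervalIntegral.integral_mono_on ht.1
          (intervalIntegrable_of_continuousOn_Icc hee ht) (i1.add i2) fun s _ => ?_
        have h1 := real_inner_le_norm (e' s) (e s)
        rw [real_inner_comm (e' s) (e s)]
        have h2 : η * ‖e' s‖ ^ 2 + 1 / η * ‖e s‖ ^ 2 - 2 * (‖e' s‖ * ‖e s‖)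
            = 1 / η * (η * ‖e' s‖ - ‖e s‖) ^ 2 := by
          field_simp; ring
        have h3 : 0 ≤ 1 / η * (η * ‖e' s‖ - ‖e s‖) ^ 2 := by positivity
        linarith
    _ = η * (∫ s in a..t, ‖e' s‖ ^ 2) + 1 / η * ∫ s in a..t, ‖e s‖ ^ 2 := by
        rw [intervalIntegral.integral_add i1 i2, intervalIntegral.integral_const_mul,
          intervalIntegral.integral_const_mul]
    _ ≤ _ := by
        refine add_le_add ?_ ?_
        · exact mul_le_mul_of_nonneg_left (integral_mono_upper ht.1 ht.2
            (intervalIntegrable_of_continuousOn_Icc he2' hb) fun _ => by positivity) hη.le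
        · exact mul_le_mul_of_nonneg_left (integral_mono_upper ht.1 ht.2
            (intervalIntegrable_of_continuousOn_Icc he2 hb) fun _ => by positivity)
            (by positivity)

/-! ### Estimates for the difference and rates of convergence -/

section Solutions

variable {k : ℕ} {t₀ T α₀ : ℝ} {D : Data k t₀ T α₀} {U₀ Uε : Trajectory k D.Ω}

theorem val_difference_eq_integral (r₀ : U₀.Regular t₀ T) (rε : Uε.Regular t₀ T) :
    ∀ t ∈ Icc t₀ T, (Uε.u t - U₀.u t).val
      = (Uε.u t₀ - U₀.u t₀).val + ∫ s in t₀..t, (Uε.ut s - U₀.ut s).val := by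
  intro t ht
  have i1 := intervalIntegrable_of_integrable_Icc (r₀.ut_mem.integrable (by simp)) ht
  have i2 := intervalIntegrable_of_integrable_Icc (rε.ut_mem.integrable (by simp)) ht
  have h : Uε.u t - U₀.u t = (Uε.u t₀ - U₀.u t₀) + ∫ s in t₀..t, (Uε.ut s - U₀.ut s) := by
    rw [intervalIntegral.integral_sub i2 i1, rε.deriv_u t ht, r₀.deriv_u t ht]
    abel
  -- A bounded linear map commutes with the Bochner integral, so the primitive in `V` becomes one in
  -- `L²`.
  have hc := (V.valL k D.Ω).intervalIntegral_comp_comm (i2.sub i1)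
  rw [h, ← V.valL_apply, map_add]
  exact congrArg _ hc.symm

theorem val_difference_deriv_eq_integral (r₀ : U₀.Regular t₀ T) (rε : Uε.Regular t₀ T) :
    ∀ t ∈ Icc t₀ T, (Uε.ut t - U₀.ut t).val
      = (Uε.ut t₀ - U₀.ut t₀).val + ∫ s in t₀..t, (Uε.utt s - U₀.utt s) := by
  intro t ht
  have i1 := intervalIntegrable_of_integrable_Icc (r₀.utt_mem.integrable (by norm_num)) ht
  have i2 := intervalIntegrable_of_integrable_Icc (rε.utt_mem.integrable (by norm_num)) ht
  rw [intervalIntegral.integral_sub i2 i1, V.val_sub, V.val_sub, rε.deriv_ut t ht,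
    r₀.deriv_ut t ht]
  abel

theorem val_difference_init {ε : ℝ} (h₀ : IsLimitSolution D U₀)
    (hε : IsPerturbedSolution D ε Uε) : (Uε.u t₀ - U₀.u t₀).val = 0 := by
  rw [V.val_sub, hε.initial, h₀.initial, sub_self]

/-- The energy estimate for the difference of the two solutions. -/
theorem difference_estimate (hT : t₀ < T) (hα₀ : 0 < α₀) {b ε : ℝ} (hb : D.betaSup ≤ b)
    (hε0 : 0 < ε) (hεb : ε < perturbationThreshold (T - t₀) α₀ b)
    (r₀ : U₀.Regular t₀ T) (h₀ : IsLimitSolution D U₀)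
    (rε : Uε.Regular t₀ T) (hε : IsPerturbedSolution D ε Uε) :
    ∀ t ∈ Icc t₀ T, 1 / 2 * ‖(Uε.u t - U₀.u t).val‖ ^ 2
        + α₀ / 2 * (∫ s in t₀..t, ‖Uε.u s - U₀.u s‖ ^ 2)
        + ε / 2 * (∫ s in t₀..t, ‖(Uε.ut s - U₀.ut s).val‖ ^ 2)
      ≤ ε / 2 * (∫ s in t₀..t, ‖U₀.utt s‖ ^ 2)
        + ε * inner ℝ (Uε.ut t - U₀.ut t).val (Uε.u t - U₀.u t).val := by
  intro t ht
  have hsub : Icc t₀ t ⊆ Icc t₀ T := Icc_subset_Icc_right ht.2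
  have hmono : volume.restrict (Icc t₀ t) ≤ volume.restrict (Icc t₀ T) :=
    Measure.restrict_mono hsub le_rfl
  have hu : MemLp (fun s => Uε.u s - U₀.u s) 2 (volume.restrict (Icc t₀ t)) :=
    ((rε.u_mem.sub r₀.u_mem).mono_exponent le_top).mono_measure hmono
  have hd : MemLp (fun s => ‖(Uε.u s - U₀.u s).d‖) 2 (volume.restrict (Icc t₀ t)) :=
    ((V.dL k D.Ω).comp_memLp' hu).norm
  have hv : MemLp (fun s => (Uε.u s - U₀.u s).val) 2 (volume.restrict (Icc t₀ t)) :=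
    (V.valL k D.Ω).comp_memLp' hu
  have htt : t ∈ Icc t₀ t := right_mem_Icc.2 ht.1
  have hsplit : ∫ s in t₀..t, ‖Uε.u s - U₀.u s‖ ^ 2
      = (∫ s in t₀..t, ‖(Uε.u s - U₀.u s).val‖ ^ 2)
        + ∫ s in t₀..t, ‖(Uε.u s - U₀.u s).d‖ ^ 2 := by
    rw [← intervalIntegral.integral_add
      (intervalIntegrable_of_integrable_Icc (hv.integrable_norm_pow (by norm_num)) htt)
      (intervalIntegrable_of_integrable_Icc hd.integrable_sq htt)]
    simp only [V.norm_sq_eq]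
  rw [hsplit]
  refine energy_estimate (L := T - t₀) (B := b) (e := fun s => (Uε.u s - U₀.u s).val)
    (e' := fun s => (Uε.ut s - U₀.ut s).val) (e'' := fun s => Uε.utt s - U₀.utt s)
    (F := U₀.utt) (d := fun s => ‖(Uε.u s - U₀.u s).d‖) ht.1 (by linarith)
    (by linarith [ht.2]) hα₀ hε0 hεb hd (((rε.utt_mem.sub r₀.utt_mem).integrable (by norm_num)).mono_measure hmono)
    (r₀.utt_mem.mono_measure hmono) (val_difference_init h₀ hε)
    (fun s hs => val_difference_eq_integral r₀ rε s (hsub hs))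
    (fun s hs => val_difference_deriv_eq_integral r₀ rε s (hsub hs)) ?_
  filter_upwards [ae_restrict_of_ae_restrict_of_subset hsub (ae_energy_inequality D h₀ hε)]
    with s hs
  refine hs.trans ?_
  gcongr

/-- The perturbed solution is within `O(ε)` of the limit solution in the square of the norm of
`L²([t₀,T]; V_x)`, and the `L²` norm of its time derivative stays bounded. -/
theorem difference_estimate_terminal (hT : t₀ < T) (hα₀ : 0 < α₀) {ε : ℝ} (hε0 : 0 < ε)
    (hε1 : ε ≤ 1) (hεb : ε < perturbationThreshold (T - t₀) α₀ D.betaSup)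
    (r₀ : U₀.Regular t₀ T) (h₀ : IsLimitSolution D U₀)
    (rε : Uε.Regular t₀ T) (hε : IsPerturbedSolution D ε Uε) :
    α₀ * (∫ s in t₀..T, ‖Uε.u s - U₀.u s‖ ^ 2)
        + ε * (∫ s in t₀..T, ‖(Uε.ut s - U₀.ut s).val‖ ^ 2)
      ≤ ε * ((∫ s in t₀..T, ‖U₀.utt s‖ ^ 2) + ‖(U₀.ut T).val‖ ^ 2) := by
  have h := difference_estimate hT hα₀ le_rfl hε0 hεb r₀ h₀ rε hε T (right_mem_Icc.2 hT.le)
  have hterm : (Uε.ut T).val = 0 := (smul_eq_zero.1 hε.terminal).resolve_left hε0.ne'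
  have hneg : (Uε.ut T - U₀.ut T).val = -(U₀.ut T).val := by rw [V.val_sub, hterm, zero_sub]
  have hin : inner ℝ (Uε.ut T - U₀.ut T).val (Uε.u T - U₀.u T).val
      ≤ ‖(U₀.ut T).val‖ * ‖(Uε.u T - U₀.u T).val‖ := by
    rw [hneg, ← norm_neg (U₀.ut T).val]
    exact real_inner_le_norm _ _
  have h1 := mul_le_mul_of_nonneg_left hin hε0.le
  -- Young's inequality, weighted so that the boundary term exactly uses up `½‖e(T)‖²` and leaves
  -- `ε² / 2` times `‖u⁰_t(T)‖²`.
  have h2 := sq_nonneg (‖(Uε.u T - U₀.u T).val‖ - ε * ‖(U₀.ut T).val‖)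
  have h3 : ε * (ε * ‖(U₀.ut T).val‖ ^ 2) ≤ ε * (1 * ‖(U₀.ut T).val‖ ^ 2) := by gcongr
  linarith

/-- Interpolation between `∫‖e‖² = O(ε)` and `∫‖e_t‖² = O(1)`: the weight `η = √ε` balances
`η∫‖e_t‖²` and `(1 / η)∫‖e‖²`. -/
theorem difference_norm_sq_le (hT : t₀ < T) (hα₀ : 0 < α₀) {ε : ℝ} (hε0 : 0 < ε)
    (hε1 : ε ≤ 1) (hεb : ε < perturbationThreshold (T - t₀) α₀ D.betaSup)
    (r₀ : U₀.Regular t₀ T) (h₀ : IsLimitSolution D U₀)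
    (rε : Uε.Regular t₀ T) (hε : IsPerturbedSolution D ε Uε) {t : ℝ} (ht : t ∈ Icc t₀ T) :
    ‖(Uε.u t - U₀.u t).val‖ ^ 2 ≤ √ε * ((1 + 1 / α₀)
      * ((∫ s in t₀..T, ‖U₀.utt s‖ ^ 2) + ‖(U₀.ut T).val‖ ^ 2)) := by
  have hTT : T ∈ Icc t₀ T := right_mem_Icc.2 hT.le
  have h := difference_estimate_terminal hT hα₀ hε0 hε1 hεb r₀ h₀ rε hε
  set G := (∫ s in t₀..T, ‖U₀.utt s‖ ^ 2) + ‖(U₀.ut T).val‖ ^ 2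
  set P := ∫ s in t₀..T, ‖(Uε.ut s - U₀.ut s).val‖ ^ 2
  have hP0 : 0 ≤ P := intervalIntegral.integral_nonneg hT.le fun _ _ => by positivity
  have hu : MemLp (fun s => Uε.u s - U₀.u s) 2 (volume.restrict (Icc t₀ T)) :=
    (rε.u_mem.sub r₀.u_mem).mono_exponent le_top
  have hv : MemLp (fun s => (Uε.u s - U₀.u s).val) 2 (volume.restrict (Icc t₀ T)) :=
    (V.valL k D.Ω).comp_memLp' hu
  have hle : ∫ s in t₀..T, ‖(Uε.u s - U₀.u s).val‖ ^ 2
      ≤ ∫ s in t₀..T, ‖Uε.u s - U₀.u s‖ ^ 2 := by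
    refine intervalIntegral.integral_mono_on hT.le
      (intervalIntegrable_of_integrable_Icc (hv.integrable_norm_pow (by norm_num)) hTT)
      (intervalIntegrable_of_integrable_Icc (hu.integrable_norm_pow (by norm_num)) hTT)
      fun s _ => ?_
    exact pow_le_pow_left₀ (norm_nonneg _) (V.norm_val_le _) 2
  set Y := ∫ s in t₀..T, ‖(Uε.u s - U₀.u s).val‖ ^ 2
  have hY0 : 0 ≤ Y := intervalIntegral.integral_nonneg hT.le fun _ _ => by positivity
  have hcont := continuousOn_of_eq_add_integral hT.le
    (intervalIntegrable_of_integrable_Icc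
      ((rε.utt_mem.sub r₀.utt_mem).integrable (by norm_num)) hTT)
    (val_difference_deriv_eq_integral r₀ rε)
  have hη : 0 < √ε := Real.sqrt_pos.2 hε0
  have hmain := norm_sq_le_of_eq_integral hη (val_difference_init h₀ hε) hcont
    (val_difference_eq_integral r₀ rε) ht
  refine hmain.trans ?_
  have hYε : α₀ * Y ≤ ε * G := by
    have := mul_le_mul_of_nonneg_left hle hα₀.le
    have : 0 ≤ ε * P := by positivity
    linarith
  have hPG : P ≤ G := by
    have : 0 ≤ α₀ * ∫ s in t₀..T, ‖Uε.u s - U₀.u s‖ ^ 2 := mul_nonneg hα₀.le (hY0.trans hle)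
    exact le_of_mul_le_mul_left (by linarith) hε0
  have hYb : 1 / √ε * Y ≤ √ε * (1 / α₀ * G) := by
    rw [one_div_mul_eq_div, div_le_iff₀ hη, one_div_mul_eq_div,
      show √ε * (G / α₀) * √ε = √ε * √ε * G / α₀ by ring, Real.mul_self_sqrt hε0.le,
      le_div_iff₀ hα₀]
    linarith
  have := mul_le_mul_of_nonneg_left hPG hη.le
  linarith

end Solutions

end SpaceTimeCD

/-! ### The energy estimate and the convergence -/

theorem mainTheorem2 (k : ℕ) (hk : k ≤ 4) (t₀ T α₀ : ℝ) (hT : t₀ < T) (hα₀ : 0 < α₀) :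
    -- the energy estimate, with a threshold for `ε` depending only on `k, t₀, T, α₀` and a
    -- bound `b` for the convection field
    (∀ b : ℝ, ∃ ε₀ : ℝ, 0 < ε₀ ∧
      ∀ (D : SpaceTimeCD.Data k t₀ T α₀), D.betaSup ≤ b →
      ∀ (U₀ : SpaceTimeCD.Trajectory k D.Ω), U₀.Regular t₀ T →
        SpaceTimeCD.IsLimitSolution D U₀ →
      ∀ (ε : ℝ), 0 < ε → ε < ε₀ →
      ∀ (Uε : SpaceTimeCD.Trajectory k D.Ω), Uε.Regular t₀ T →
        SpaceTimeCD.IsPerturbedSolution D ε Uε →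
        0 < D.c0 ε ∧
        ∀ t ∈ Set.Icc t₀ T,
          1 / 2 * ‖(Uε.u t - U₀.u t).val‖ ^ 2
            + D.c0 ε * ∫ s in t₀..t, ‖Uε.u s - U₀.u s‖ ^ 2
          ≤ ε / 2 * Real.exp (2 * D.Cl * (t - t₀)) * (∫ s in t₀..t, ‖U₀.utt s‖ ^ 2)
            + ε * ‖(Uε.ut t - U₀.ut t).val‖ * ‖Uε.u t - U₀.u t‖) ∧
    -- the convergence of the perturbed solutions
    (∀ (D : SpaceTimeCD.Data k t₀ T α₀)
      (U₀ : SpaceTimeCD.Trajectory k D.Ω), U₀.Regular t₀ T →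
        SpaceTimeCD.IsLimitSolution D U₀ →
      ∀ (U : ℝ → SpaceTimeCD.Trajectory k D.Ω),
        (∀ᶠ ε in 𝓝[>] (0 : ℝ), (U ε).Regular t₀ T ∧
          SpaceTimeCD.IsPerturbedSolution D ε (U ε)) →
        (∀ t ∈ Set.Icc t₀ T,
          Tendsto (fun ε => ‖((U ε).u t - U₀.u t).val‖) (𝓝[>] (0 : ℝ)) (𝓝 0)) ∧
        Tendsto (fun ε => ∫ s in t₀..T, ‖(U ε).u s - U₀.u s‖ ^ 2) (𝓝[>] (0 : ℝ)) (𝓝 0)) := by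

  refine ⟨fun b => ?_, fun D U₀ r₀ h₀ U hU => ?_⟩
  · have hpos : 0 < α₀ / 2 / ((b / (2 * α₀)) ^ 2 + 1 / 2) := by positivity
    -- The second entry of the minimum guarantees `c₀ > 0` uniformly over `betaSup ≤ b`.
    refine ⟨min (SpaceTimeCD.perturbationThreshold (T - t₀) α₀ b)
      (α₀ / 2 / ((b / (2 * α₀)) ^ 2 + 1 / 2)),
      lt_min (SpaceTimeCD.perturbationThreshold_pos b (sub_pos.2 hT) hα₀) hpos, ?_⟩
    intro D hb U₀ r₀ h₀ ε hε0 hε Uε rε hUε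
    have hCl0 : 0 ≤ D.Cl := div_nonneg D.betaSup_nonneg (by positivity)
    have hCl : D.Cl ≤ b / (2 * α₀) := div_le_div_of_nonneg_right hb (by positivity)
    have hc0 : 0 < D.c0 ε := by
      have h1 := (lt_div_iff₀ (by positivity)).1 (hε.trans_le (min_le_right _ _))
      have h2 : ε * (D.Cl ^ 2 + 1 / 2) ≤ ε * ((b / (2 * α₀)) ^ 2 + 1 / 2) := by gcongr
      unfold SpaceTimeCD.Data.c0
      linarith
    have hc0le : D.c0 ε ≤ α₀ / 2 := by
      have : 0 ≤ ε * (D.Cl ^ 2 + 1 / 2) := by positivity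
      unfold SpaceTimeCD.Data.c0
      linarith
    refine ⟨hc0, fun t ht => ?_⟩
    have h := SpaceTimeCD.difference_estimate hT hα₀ hb hε0 (hε.trans_le (min_le_left _ _))
      r₀ h₀ rε hUε t ht
    have hS : 0 ≤ ∫ s in t₀..t, ‖Uε.u s - U₀.u s‖ ^ 2 :=
      intervalIntegral.integral_nonneg ht.1 fun _ _ => by positivity
    have hP : 0 ≤ ∫ s in t₀..t, ‖(Uε.ut s - U₀.ut s).val‖ ^ 2 :=
      intervalIntegral.integral_nonneg ht.1 fun _ _ => by positivity
    have hQ : 0 ≤ ∫ s in t₀..t, ‖U₀.utt s‖ ^ 2 :=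
      intervalIntegral.integral_nonneg ht.1 fun _ _ => by positivity
    -- The exponential is pure slack here, as are `c₀ ≤ α₀ / 2` and the `V` norm of `e(t)` in the
    -- boundary term.
    have hexp : 1 ≤ Real.exp (2 * D.Cl * (t - t₀)) :=
      Real.one_le_exp (mul_nonneg (by positivity) (sub_nonneg.2 ht.1))
    have h1 := mul_le_mul_of_nonneg_right hc0le hS
    have h2 : ε / 2 * 1 * (∫ s in t₀..t, ‖U₀.utt s‖ ^ 2)
        ≤ ε / 2 * Real.exp (2 * D.Cl * (t - t₀)) * ∫ s in t₀..t, ‖U₀.utt s‖ ^ 2 := by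
      gcongr
    have h3 : inner ℝ (Uε.ut t - U₀.ut t).val (Uε.u t - U₀.u t).val
        ≤ ‖(Uε.ut t - U₀.ut t).val‖ * ‖Uε.u t - U₀.u t‖ :=
      (real_inner_le_norm _ _).trans
        (mul_le_mul_of_nonneg_left (SpaceTimeCD.V.norm_val_le _) (norm_nonneg _))
    have h4 := mul_le_mul_of_nonneg_left h3 hε0.le
    have h5 : 0 ≤ ε / 2 * ∫ s in t₀..t, ‖(Uε.ut s - U₀.ut s).val‖ ^ 2 := by positivity
    linarith
  · have hsmall : ∀ᶠ ε in 𝓝[>] (0 : ℝ), 0 < ε ∧ ε ≤ 1 ∧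
        ε < SpaceTimeCD.perturbationThreshold (T - t₀) α₀ D.betaSup := by
      filter_upwards [Ioo_mem_nhdsGT (lt_min one_pos
        (SpaceTimeCD.perturbationThreshold_pos D.betaSup (sub_pos.2 hT) hα₀))] with ε hε
      exact ⟨hε.1, (hε.2.trans_le (min_le_left _ _)).le, hε.2.trans_le (min_le_right _ _)⟩
    set G := (∫ s in t₀..T, ‖U₀.utt s‖ ^ 2) + ‖(U₀.ut T).val‖ ^ 2 with hG
    have hid : Tendsto (fun ε : ℝ => ε) (𝓝[>] (0 : ℝ)) (𝓝 0) := nhdsWithin_le_nhds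
    constructor
    · intro t ht
      have hsq : Tendsto (fun ε => ‖((U ε).u t - U₀.u t).val‖ ^ 2) (𝓝[>] (0 : ℝ)) (𝓝 0) := by
        refine tendsto_of_tendsto_of_tendsto_of_le_of_le' tendsto_const_nhds
          (h := fun ε => √ε * ((1 + 1 / α₀) * G)) ?_
          (Eventually.of_forall fun _ => by positivity) ?_
        · have := (Real.continuous_sqrt.tendsto 0).comp hid
          rw [Real.sqrt_zero] at this
          simpa using this.mul_const ((1 + 1 / α₀) * G)
        · filter_upwards [hsmall, hU] with ε hε hUε
          exact SpaceTimeCD.difference_norm_sq_le hT hα₀ hε.1 hε.2.1 hε.2.2 r₀ h₀ hUε.1 hUε.2 ht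
      have := (Real.continuous_sqrt.tendsto 0).comp hsq
      rw [Real.sqrt_zero] at this
      exact this.congr fun ε => Real.sqrt_sq (norm_nonneg _)
    · refine tendsto_of_tendsto_of_tendsto_of_le_of_le' tendsto_const_nhds
        (h := fun ε => ε * (G / α₀)) (by simpa using hid.mul_const (G / α₀))
        (Eventually.of_forall fun _ =>
          intervalIntegral.integral_nonneg hT.le fun _ _ => by positivity) ?_
      filter_upwards [hsmall, hU] with ε hε hUε
      have h := SpaceTimeCD.difference_estimate_terminal hT hα₀ hε.1 hε.2.1 hε.2.2 r₀ h₀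
        hUε.1 hUε.2
      have hP : 0 ≤ ∫ s in t₀..T, ‖((U ε).ut s - U₀.ut s).val‖ ^ 2 :=
        intervalIntegral.integral_nonneg hT.le fun _ _ => by positivity
      have hεP := mul_nonneg hε.1.le hP
      rw [← mul_div_assoc, le_div_iff₀ hα₀]
      linarith
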